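/- Let $n\ge 1$, $s_0\in(0,1)$, $\Lambda\ge 1$, $p>1$ and $s_1,\dots,s_n\in[s_0,1)$. Put $s_{\max}=\max_k s_k$, $\bar s=\big(\frac1n\sum_{k=1}^n \frac1{s_k}\big)^{-1}$, and for $r>0$, $x\in\mathbb R^n$, $$E_r^k(x)=\{y\in\mathbb R^n:|x_k-y_k|<r^{s_{\max}/s_k}\},\qquad M_r(x)=\bigcap_{k=1}^n E_r^k(x).$$ Let $\mu_{\mathrm{axes}}(x,\mathrm dy)=\sum_{k=1}^n s_k(1-s_k)|x_k-y_k|^{-1-s_kp}\,\mathrm dy_k\prod_{i\ne k}\delta_{x_i}(\mathrm dy_i)$. For a family $\mu=(\mu(x,\cdot))_{x\in\mathbb R^n}$ of Borel measures on $\mathbb R^n$ such that $x\mapsto\mu(x,B)$ is measurable for every Borel set $B$, and for $\Omega\subset\mathbb R^n$ open, write $$\mathcal E^\mu_\Omega(u,u)=\int_\Omega\int_\Omega|u(y)-u(x)|^p\,\mu(x,\mathrm dy)\,\mathrm dx\in[0,\infty].$$ Such a family belongs to $\mathcal K(p,s_0,\Lambda)$ if 1. $\sup_{x\in\mathbb R^n}\int_{\mathbb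 R^n}(|x-y|^p\wedge1)\,\mu(x,\mathrm dy)<\infty$, and $\int_A\mu(x,B)\,\mathrm dx=\int_B\mu(x,A)\,\mathrm dx$ for all Borel sets $A,B\subset\mathbb R^n$; 2. $\mu(x_0,\mathbb R^n\setminus E_r^k(x_0))\le\Lambda(1-s_k)r^{-ps_{\max}}$ for all $x_0\in\mathbb R^n$, $k\in\{1,\dots,n\}$ and $r>0$; 3. $\Lambda^{-1}\mathcal E^\mu_{M_\rho(x_0)}(u,u)\le\mathcal E^{\mu_{\mathrm{axes}}}_{M_\rho(x_0)}(u,u)\le\Lambda\,\mathcal E^\mu_{M_\rho(x_0)}(u,u)$ for all $x_0\in\mathbb R^n$, $\rho\in(0,3)$ and $u\in L^p(M_\rho(x_0))$. Let $H^{p,\mu}_\Omega(\mathbb R^n)$ be the set of measurable $u:\mathbb R^n\to\mathbb R$ with $u\equiv0$ on $\mathbb R^n\setminus\Omega$ and $\|u\|_{L^p(\Omega)}^p+\mathcal E^\mu_{\mathbb R^n}(u,u)<\infty$. **Localized Sobolev inequality.** Suppose that $1<p<n/\bar s$ and let $p_\star=np/(n-p\bar s)$. There is a constant $C>0$, depending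 only on $n$, $p$, $p_\star$, $s_0$ and $\Lambda$, such that for every $\mu\in\mathcal K(p,s_0,\Lambda)$, every $x_0\in\mathbb R^n$, $r\in(0,1]$, $\lambda\in(1,2]$ and every $u\in H^{p,\mu}_{M_{\lambda r}(x_0)}(\mathbb R^n)$, $$\|u\|_{L^{p_\star}(M_r(x_0))}^p\le C\int_{M_{\lambda r}(x_0)}\int_{M_{\lambda r}(x_0)}|u(x)-u(y)|^p\,\mu(x,\mathrm dy)\,\mathrm dx+C\Big(\sum_{k=1}^n\big(\lambda^{s_{\max}/s_k}-1\big)^{-s_kp}\Big)r^{-ps_{\max}}\|u\|_{L^p(M_{\lambda r}(x_0))}^p.$$ -/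

import Mathlib

open MeasureTheory
open scoped ENNReal

noncomputable section

namespace AnisotropicNonlocal

/-- Euclidean space `ℝⁿ`, with the Euclidean norm and Lebesgue measure. -/
abbrev Space (n : ℕ) : Type := EuclideanSpace ℝ (Fin n)

/-- `s_max = max {s_1, …, s_n}` (a maximum, since `Fin n` is finite; used for `n ≥ 1`). -/
def sMax {n : ℕ} (s : Fin n → ℝ) : ℝ := ⨆ k, s k

/-- The harmonic mean `s̄ = (n⁻¹ ∑ₖ 1 / s_k)⁻¹` of the orders. -/
def sBar {n : ℕ} (s : Fin n → ℝ) : ℝ := (1 / (n : ℝ) * ∑ k, 1 / s k)⁻¹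

/-- The Sobolev exponent `p_⋆ = n p / (n - p s̄)`. -/
def sobolevExponent {n : ℕ} (p : ℝ) (s : Fin n → ℝ) : ℝ :=
  (n : ℝ) * p / ((n : ℝ) - p * sBar s)

/-- The strip `E_r^k(x) = {y : |x_k - y_k| < r ^ (s_max / s_k)}`. -/
def strip {n : ℕ} (s : Fin n → ℝ) (r : ℝ) (k : Fin n) (x : Space n) : Set (Space n) :=
  {y | |x k - y k| < r ^ (sMax s / s k)}

/-- The anisotropic open rectangle
`M_r(x) = ∏ₖ (x_k - r ^ (s_max / s_k), x_k + r ^ (s_max / s_k))`. -/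
def rect {n : ℕ} (s : Fin n → ℝ) (r : ℝ) (x : Space n) : Set (Space n) :=
  {y | ∀ k, y k ∈ Set.Ioo (x k - r ^ (sMax s / s k)) (x k + r ^ (sMax s / s k))}

/-- The reference family
`μ_axes(x, dy) = ∑ₖ s_k (1 - s_k) |x_k - y_k| ^ (-1 - s_k p) dy_k ∏_{i ≠ k} δ_{x_i}(dy_i)`.
With `y_k = x_k + h`, the `k`-th summand is the image of the measure
`s_k (1 - s_k) |h| ^ (-1 - s_k p) dh` on `ℝ` under `h ↦ x + h e_k`. -/
def muAxes {n : ℕ} (p : ℝ) (s : Fin n → ℝ) (x : Space n) : Measure (Space n) :=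
  ∑ k, Measure.map (fun h : ℝ => x + EuclideanSpace.single k h)
    ((volume : Measure ℝ).withDensity
      fun h => ENNReal.ofReal (s k * (1 - s k) * |h| ^ (-1 - s k * p)))

/-- The `p`-energy `∫_Ω ∫_Ω |u(y) - u(x)| ^ p μ(x, dy) dx ∈ [0, ∞]`. It is `ℰ_Ω^μ(u, u)`,
because `|t| ^ (p - 2) * t * t = |t| ^ p` for real `t` and `p > 1`. -/
def energy {n : ℕ} (p : ℝ) (μ : Space n → Measure (Space n)) (Ω : Set (Space n))
    (u : Space n → ℝ) : ℝ≥0∞ :=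
  ∫⁻ x in Ω, ∫⁻ y in Ω, ENNReal.ofReal (|u y - u x| ^ p) ∂(μ x)

/-- `‖u‖_{L^q(Ω)} ∈ [0, ∞]` with respect to Lebesgue measure, for a real exponent `q > 0`. -/
def normL {n : ℕ} (q : ℝ) (Ω : Set (Space n)) (u : Space n → ℝ) : ℝ≥0∞ :=
  eLpNorm u (ENNReal.ofReal q) (volume.restrict Ω)

/-- The class `𝒦(p, s₀, Λ)` of admissible families `(μ(x, ·))_x` of Borel measures, for orders
`s_1, …, s_n ∈ [s₀, 1)`: integrability and symmetry, the tail bound in each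
coordinate direction, and local comparability with `μ_axes`. -/
structure Admissible {n : ℕ} (p : ℝ) (s : Fin n → ℝ) (Λ : ℝ)
    (μ : Space n → Measure (Space n)) : Prop where
  /-- `x ↦ μ(x, B)` is measurable for every Borel set `B`. -/
  measurable : Measurable μ
  integrable : (⨆ x, ∫⁻ y, ENNReal.ofReal (min (‖x - y‖ ^ p) 1) ∂(μ x)) < ∞
  symmetric : ∀ A B : Set (Space n), MeasurableSet A → MeasurableSet B →
    ∫⁻ x in A, μ x B = ∫⁻ x in B, μ x A
  tail : ∀ (x₀ : Space n) (k : Fin n) (r : ℝ), 0 < r →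
    μ x₀ (strip s r k x₀)ᶜ ≤ ENNReal.ofReal (Λ * (1 - s k) * r ^ (-(p * sMax s)))
  comparable : ∀ (x₀ : Space n) (ρ : ℝ), 0 < ρ → ρ < 3 → ∀ u : Space n → ℝ,
    MemLp u (ENNReal.ofReal p) (volume.restrict (rect s ρ x₀)) →
      ENNReal.ofReal Λ⁻¹ * energy p μ (rect s ρ x₀) u ≤ energy p (muAxes p s) (rect s ρ x₀) u ∧
      energy p (muAxes p s) (rect s ρ x₀) u ≤ ENNReal.ofReal Λ * energy p μ (rect s ρ x₀) u

/-- `u ∈ H^{p,μ}_Ω(ℝⁿ)`: `u` is measurable, vanishes on `ℝⁿ \ Ω`, and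
`‖u‖_{L^p(Ω)} ^ p + ∫∫ |u(y) - u(x)| ^ p μ(x, dy) dx` over `ℝⁿ × ℝⁿ` is finite. -/
structure MemH {n : ℕ} (p : ℝ) (μ : Space n → Measure (Space n)) (Ω : Set (Space n))
    (u : Space n → ℝ) : Prop where
  measurable : Measurable u
  eq_zero : ∀ x, x ∉ Ω → u x = 0
  finite : normL p Ω u ^ p + energy p μ Set.univ u < ∞

end AnisotropicNonlocal

end

open AnisotropicNonlocal

/-!
The inequality follows from an anisotropic Sobolev inequality on the whole space, applied to the
product of `u` with a cutoff function. Comparability on the outer rectangle is used for `u` itself,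
so that `μ` enters only there.

*Global inequality.* Let `G k h` be the `p`-th power of the `L^p` norm of `w(· + h eₖ) - w`. As
`G k (2 h) ≤ 2 ^ p * G k h`, the part of `∫ G k h * |h| ^ (-1 - s k p) dh` over a dyadic interval
`(T, 2T]` is at most a fraction `(1 - s k) p` of the whole (`lintegral_dyadic_le`), which makes all
constants uniform as `s k → 1`. If `w` is supported in a set of measure `a`, then at least half of
the increments in a box of volume `2 a` move a given point out of the support. Comparing `w` with
its translates by the box, with sides `T k = τ ^ (1 / s k)`, gives the Nash-type inequality
`rpow_mul_volume_le_axesEnergy` for the measure of a level set. It is applied to the slices of `|v|`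
between consecutive dyadic heights: their energies add up to at most the energy of `v`
(`tsum_axesEnergy_dyadicSlice_le`), and an absorption argument over the levels (`tsum_dyadic_le`)
turns the weak-type bounds into the strong one (`lintegral_rpow_le_axesEnergy`).

*Localization.* For the product cutoff with slopes `1 / d k`, where `d k` is the gap between the two
rectangles in direction `k`, the discrete product rule splits the energy of `cutoff * u` into the
energy of `u` over pairs in the outer rectangle and the `L^p` norm of `u` times the energy density
of the cutoff. The latter is of order `∑ d k ^ (-s k p)`, again uniformly in the orders
(`lintegral_cutoff_kernel_le`, `axesEnergy_cutoff_mul_le`).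
-/

namespace AnisotropicNonlocal

open Set

/-! ### Moduli of continuity and directional energies -/

lemma ofReal_abs_rpow {p : ℝ} (hp : 0 ≤ p) (t : ℝ) : ENNReal.ofReal (|t| ^ p) = ‖t‖ₑ ^ p := by
  rw [← ENNReal.ofReal_rpow_of_nonneg (abs_nonneg t) hp, ← Real.norm_eq_abs, ofReal_norm]

lemma enorm_add_rpow_le {p : ℝ} (hp : 1 ≤ p) (a b : ℝ) :
    ‖a + b‖ₑ ^ p ≤ 2 ^ (p - 1) * (‖a‖ₑ ^ p + ‖b‖ₑ ^ p) :=
  (ENNReal.rpow_le_rpow (enorm_add_le a b) (by linarith)).trans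
    (ENNReal.rpow_add_le_mul_rpow_add_rpow _ _ hp)

/-- The `p`-th power of the `L^p` modulus of continuity of `w` under translation by `a`. -/
noncomputable def shiftMod {n : ℕ} (p : ℝ) (w : Space n → ℝ) (a : Space n) : ℝ≥0∞ :=
  ∫⁻ x, ‖w (x + a) - w x‖ₑ ^ p

/-- The directional energy `∫ ‖w(· + h eₖ) - w‖ₚᵖ |h|^(-1-σp) dh`, for order `σ`
and without the normalizing factor `σ (1 - σ)`. -/
noncomputable def dirEnergy {n : ℕ} (p σ : ℝ) (k : Fin n) (w : Space n → ℝ) : ℝ≥0∞ :=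
  ∫⁻ h : ℝ, shiftMod p w (EuclideanSpace.single k h) * ENNReal.ofReal (|h| ^ (-1 - σ * p))

/-- The energy of `muAxes p s` over the whole space, written as an integral over increments. -/
noncomputable def axesEnergy {n : ℕ} (p : ℝ) (s : Fin n → ℝ) (w : Space n → ℝ) : ℝ≥0∞ :=
  ∑ k, ENNReal.ofReal (s k * (1 - s k)) * dirEnergy p (s k) k w

section Shift

variable {n : ℕ} {p : ℝ} {w : Space n → ℝ}

lemma measurable_diff_rpow (hw : Measurable w) :
    Measurable fun z : Space n × Space n => ‖w (z.1 + z.2) - w z.1‖ₑ ^ p := by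
  fun_prop

lemma measurable_shiftMod (hw : Measurable w) : Measurable (shiftMod p w) :=
  Measurable.lintegral_prod_left' (f := fun z : Space n × Space n => ‖w (z.1 + z.2) - w z.1‖ₑ ^ p)
    (measurable_diff_rpow hw)

lemma shiftMod_zero (hp : 0 < p) : shiftMod p w 0 = 0 := by
  simp [shiftMod, hp]

lemma shiftMod_add_le (hp : 1 ≤ p) (hw : Measurable w) (a b : Space n) :
    shiftMod p w (a + b) ≤ 2 ^ (p - 1) * (shiftMod p w a + shiftMod p w b) := by
  have hb : ∫⁻ x, ‖w (x + a + b) - w (x + a)‖ₑ ^ p = shiftMod p w b :=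
    lintegral_add_right_eq_self (fun x => ‖w (x + b) - w x‖ₑ ^ p) a
  rw [← hb, shiftMod, shiftMod, ← lintegral_add_left (by fun_prop),
    ← lintegral_const_mul _ (by fun_prop)]
  refine lintegral_mono fun x => ?_
  have := enorm_add_rpow_le hp (w (x + a) - w x) (w (x + a + b) - w (x + a))
  rwa [show w (x + a) - w x + (w (x + a + b) - w (x + a)) = w (x + (a + b)) - w x by
    rw [add_assoc]; ring] at this

lemma shiftMod_two_mul_le (hp : 1 ≤ p) (hw : Measurable w) (k : Fin n) (h : ℝ) :
    shiftMod p w (EuclideanSpace.single k (2 * h)) ≤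
      2 ^ p * shiftMod p w (EuclideanSpace.single k h) := by
  have := shiftMod_add_le hp hw (EuclideanSpace.single k h) (EuclideanSpace.single k h)
  rw [← two_mul, ← mul_assoc] at this
  have h2 : (2 : ℝ≥0∞) ^ (p - 1) * 2 = 2 ^ p := by
    nth_rewrite 2 [← ENNReal.rpow_one (2 : ℝ≥0∞)]
    rw [← ENNReal.rpow_add _ _ (by simp) (by simp), sub_add_cancel]
  rw [h2] at this
  convert this using 2
  ext i
  by_cases hi : i = k <;> simp [hi, two_mul]

lemma shiftMod_sum_le (hp : 1 ≤ p) (hw : Measurable w) {ι : Type*} (S : Finset ι)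
    (a : ι → Space n) :
    shiftMod p w (∑ k ∈ S, a k) ≤ (2 ^ (p - 1)) ^ S.card * ∑ k ∈ S, shiftMod p w (a k) := by
  classical
  induction S using Finset.induction_on with
  | empty => simp [shiftMod_zero (w := w) (by linarith : 0 < p)]
  | insert k S hk ih =>
    rw [Finset.sum_insert hk, Finset.sum_insert hk, Finset.card_insert_of_notMem hk, pow_succ']
    refine (shiftMod_add_le hp hw _ _).trans ?_
    rw [mul_assoc, mul_add ((2 ^ (p - 1)) ^ S.card)]
    gcongr
    refine le_mul_of_one_le_left (zero_le) (one_le_pow₀ ?_)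
    simpa using ENNReal.rpow_le_rpow_of_exponent_le (x := 2) (by norm_num) (sub_nonneg.2 hp)

end Shift

/-! ### Dyadic intervals of increments -/

lemma setLIntegral_Ioc_two_mul (F : ℝ → ℝ≥0∞) (T : ℝ) :
    ∫⁻ h in Ioc 0 (2 * T), F h = 2 * ∫⁻ h in Ioc 0 T, F (2 * h) := by
  rw [← lintegral_indicator measurableSet_Ioc, ← lintegral_indicator measurableSet_Ioc]
  conv_lhs => rw [← Real.smul_map_volume_mul_left (two_ne_zero' ℝ)]
  rw [lintegral_smul_measure]
  have := lintegral_map_equiv (μ := volume) ((Ioc 0 (2 * T)).indicator F)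
    (Homeomorph.mulLeft₀ (2 : ℝ) two_ne_zero).toMeasurableEquiv
  simp only [Homeomorph.toMeasurableEquiv_coe, Homeomorph.coe_mulLeft₀] at this
  rw [this]
  simp only [smul_eq_mul, abs_two, ENNReal.ofReal_ofNat]
  congr 2
  ext h
  simp [indicator, mem_Ioc]

lemma one_sub_two_rpow_neg_le (x : ℝ) (hx : 0 ≤ x) : 1 - (2 : ℝ) ^ (-x) ≤ x := by
  rw [Real.rpow_def_of_pos two_pos]
  have h1 := Real.add_one_le_exp (Real.log 2 * -x)
  have h2 := Real.log_two_lt_d9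
  nlinarith

/-- The gain of the factor `1 - σ`: a modulus that at most grows by `2^p` under doubling of the
increment puts only a fraction `(1 - σ) p` of its weighted mass on `(0, 2T]` into `(T, 2T]`. The
masses `J` of `(0, 2T]` and `J'` of `(0, T]` satisfy `J' ≥ 2^(-(1 - σ) p) J` by scaling, and
`1 - 2^(-x) ≤ x`. -/
lemma lintegral_dyadic_le {G : ℝ → ℝ≥0∞} {p σ T : ℝ} (hp : 0 < p) (hσ : σ < 1) (hT : 0 < T)
    (hG : ∀ h, G (2 * h) ≤ 2 ^ p * G h) :
    ∫⁻ h in Ioc T (2 * T), G h * ENNReal.ofReal (|h| ^ (-1 - σ * p)) ≤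
      ENNReal.ofReal ((1 - σ) * p) *
        ∫⁻ h in Ioc 0 (2 * T), G h * ENNReal.ofReal (|h| ^ (-1 - σ * p)) := by
  set F : ℝ → ℝ≥0∞ := fun h => G h * ENNReal.ofReal (|h| ^ (-1 - σ * p)) with hF
  have hx : 0 < (1 - σ) * p := mul_pos (by linarith) hp
  have hsplit : ∫⁻ h in Ioc 0 (2 * T), F h =
      (∫⁻ h in Ioc 0 T, F h) + ∫⁻ h in Ioc T (2 * T), F h := by
    rw [← lintegral_union measurableSet_Ioc (Ioc_disjoint_Ioc_of_le le_rfl),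
      Ioc_union_Ioc_eq_Ioc hT.le (by linarith)]
  have hscale : ∫⁻ h in Ioc 0 (2 * T), F h ≤
      ENNReal.ofReal (2 ^ ((1 - σ) * p)) * ∫⁻ h in Ioc 0 T, F h := by
    rw [setLIntegral_Ioc_two_mul, ← lintegral_const_mul' _ _ (by simp),
      ← lintegral_const_mul' _ _ (by simp)]
    refine lintegral_mono fun h => ?_
    have e : (2 : ℝ≥0∞) * (2 ^ p * ENNReal.ofReal (2 ^ (-1 - σ * p))) =
        ENNReal.ofReal (2 ^ ((1 - σ) * p)) := by
      have h2 : (2 : ℝ≥0∞) = ENNReal.ofReal 2 := by simp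
      rw [h2, ENNReal.ofReal_rpow_of_pos two_pos, ← ENNReal.ofReal_mul (by positivity),
        ← ENNReal.ofReal_mul (by positivity)]
      congr 1
      rw [← Real.rpow_add two_pos]
      nth_rewrite 1 [← Real.rpow_one 2]
      rw [← Real.rpow_add two_pos]
      congr 1
      ring
    simp only [hF]
    rw [abs_mul, abs_two, Real.mul_rpow two_pos.le (abs_nonneg h),
      ENNReal.ofReal_mul (by positivity), ← e]
    calc 2 * (G (2 * h) * (ENNReal.ofReal (2 ^ (-1 - σ * p)) *
            ENNReal.ofReal (|h| ^ (-1 - σ * p))))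
        ≤ 2 * (2 ^ p * G h * (ENNReal.ofReal (2 ^ (-1 - σ * p)) *
            ENNReal.ofReal (|h| ^ (-1 - σ * p)))) := by gcongr; exact hG h
      _ = _ := by ring
  -- An infinite mass makes the right-hand side infinite, because `(1 - σ) p > 0`.
  by_cases htop : ∫⁻ h in Ioc 0 (2 * T), F h = ∞
  · rw [htop, ENNReal.mul_top (by simpa using hx)]
    exact le_top
  · have h1 : ∫⁻ h in Ioc 0 T, F h ≠ ∞ :=
      ne_top_of_le_ne_top htop (by rw [hsplit]; exact le_self_add)
    have h2 : ∫⁻ h in Ioc T (2 * T), F h ≠ ∞ :=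
      ne_top_of_le_ne_top htop (by rw [hsplit]; exact le_add_self)
    rw [hsplit] at hscale ⊢
    lift (∫⁻ h in Ioc 0 T, F h) to NNReal using h1 with a
    lift (∫⁻ h in Ioc T (2 * T), F h) to NNReal using h2 with b
    rw [← ENNReal.ofReal_coe_nnreal, ← ENNReal.ofReal_coe_nnreal, ← ENNReal.ofReal_add (by simp)
      (by simp), ← ENNReal.ofReal_mul (by positivity), ENNReal.ofReal_le_ofReal_iff
      (by positivity)] at hscale ⊢
    have hq := one_sub_two_rpow_neg_le _ hx.le
    rw [Real.rpow_neg two_pos.le] at hq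
    set q := (2 : ℝ) ^ ((1 - σ) * p)
    have hq0 : 0 < q := by positivity
    have h3 : q⁻¹ * (a + b : ℝ) ≤ a := by
      rw [inv_mul_le_iff₀ hq0]; exact hscale
    have : (0 : ℝ) ≤ a + b := by positivity
    nlinarith

/-- The mean of the modulus over `(T, 2T]`, bounded by the energy with its factor `1 - σ`. -/
lemma lintegral_Ioc_le_energy {G : ℝ → ℝ≥0∞} {p σ T : ℝ} (hp : 0 < p) (hσ0 : 0 < σ) (hσ : σ < 1)
    (hT : 0 < T) (hG : ∀ h, G (2 * h) ≤ 2 ^ p * G h) :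
    ∫⁻ h in Ioc T (2 * T), G h ≤
      ENNReal.ofReal (2 ^ (1 + p) * p * T * T ^ (σ * p)) * (ENNReal.ofReal (1 - σ) *
        ∫⁻ h, G h * ENNReal.ofReal (|h| ^ (-1 - σ * p))) := by
  have hσp : 0 < σ * p := mul_pos hσ0 hp
  calc ∫⁻ h in Ioc T (2 * T), G h
      ≤ ∫⁻ h in Ioc T (2 * T), ENNReal.ofReal ((2 * T) ^ (1 + σ * p)) *
          (G h * ENNReal.ofReal (|h| ^ (-1 - σ * p))) := by
        refine setLIntegral_mono' measurableSet_Ioc fun h hh => ?_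
        have h0 : 0 < h := hT.trans hh.1
        rw [mul_left_comm, ← ENNReal.ofReal_mul (by positivity), abs_of_pos h0]
        refine le_mul_of_one_le_right zero_le ?_
        rw [ENNReal.one_le_ofReal, show -1 - σ * p = -(1 + σ * p) by ring,
          Real.rpow_neg h0.le, ← div_eq_mul_inv, one_le_div (by positivity)]
        exact Real.rpow_le_rpow h0.le hh.2 (by positivity)
    _ = ENNReal.ofReal ((2 * T) ^ (1 + σ * p)) *
          ∫⁻ h in Ioc T (2 * T), G h * ENNReal.ofReal (|h| ^ (-1 - σ * p)) :=
        lintegral_const_mul' _ _ (by simp)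
    _ ≤ ENNReal.ofReal ((2 * T) ^ (1 + σ * p)) * (ENNReal.ofReal ((1 - σ) * p) *
          ∫⁻ h, G h * ENNReal.ofReal (|h| ^ (-1 - σ * p))) := by
        gcongr
        exact (lintegral_dyadic_le hp hσ hT hG).trans (by gcongr; exact Measure.restrict_le_self)
    _ ≤ _ := by
        rw [← mul_assoc, ← mul_assoc, ← ENNReal.ofReal_mul (by positivity),
          ← ENNReal.ofReal_mul (by positivity)]
        refine mul_le_mul_left (ENNReal.ofReal_le_ofReal ?_) _
        rw [Real.mul_rpow two_pos.le hT.le, Real.rpow_add hT, Real.rpow_one]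
        have : (2 : ℝ) ^ (1 + σ * p) ≤ 2 ^ (1 + p) :=
          Real.rpow_le_rpow_of_exponent_le (by norm_num) (by nlinarith)
        have h1 : 0 ≤ 1 - σ := by linarith
        calc 2 ^ (1 + σ * p) * (T * T ^ (σ * p)) * ((1 - σ) * p)
            ≤ 2 ^ (1 + p) * (T * T ^ (σ * p)) * ((1 - σ) * p) := by gcongr
          _ = _ := by ring

/-! ### A Nash-type inequality for level sets -/

section Nash

variable {n : ℕ} {p : ℝ} {w : Space n → ℝ}

lemma setLIntegral_box_eval (T : Fin n → ℝ) (hT : ∀ k, 0 < T k) (k : Fin n) {F : ℝ → ℝ≥0∞}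
    (hF : Measurable F) :
    ∫⁻ h in univ.pi fun i => Ioc (T i) (2 * T i), F (h k) =
      (∏ i, ENNReal.ofReal (T i)) * ((ENNReal.ofReal (T k))⁻¹ *
        ∫⁻ t in Ioc (T k) (2 * T k), F t) := by
  have h1 : ∀ i, volume (Ioc (T i) (2 * T i)) = ENNReal.ofReal (T i) := fun i => by
    rw [Real.volume_Ioc]; congr 1; ring
  have h0 : ENNReal.ofReal (T k) ≠ 0 := by simpa using hT k
  have hpre : ∫⁻ h in univ.pi fun i => Ioc (T i) (2 * T i), F (h k) =
      ∫⁻ t, F t ∂((volume.restrict (univ.pi fun i => Ioc (T i) (2 * T i))).map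
        (Function.eval k)) := by
    rw [lintegral_map hF (measurable_pi_apply k)]
  rw [hpre, volume_pi, Measure.restrict_pi_pi, Measure.pi_map_eval, lintegral_smul_measure,
    smul_eq_mul, ← mul_assoc]
  congr 1
  rw [← Finset.prod_erase_mul _ _ (Finset.mem_univ k), mul_assoc,
    ENNReal.mul_inv_cancel h0 (by simp), mul_one]
  exact Finset.prod_congr rfl fun i _ => by simp [h1]

lemma measurable_single (k : Fin n) :
    Measurable fun h : ℝ => (EuclideanSpace.single k h : Space n) :=
  (Isometry.continuous fun a b =>
    PiLp.edist_single_same 2 (fun _ : Fin n => ℝ) k a b).measurable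

lemma toLp_eq_sum_single (h : Fin n → ℝ) :
    (WithLp.toLp 2 h : Space n) = ∑ k, EuclideanSpace.single k (h k) := by
  ext i
  simp [Finset.sum_apply]

/-- A function supported in a set of at most half the volume of a box of increments changes by its
full size under at least half of these increments. -/
lemma rpow_mul_volume_le_sum_shiftMod (hp : 1 ≤ p) (hw : Measurable w) (T : Fin n → ℝ)
    (hT : ∀ k, 0 < T k) (L : ℝ≥0∞)
    (hA : 2 * volume {x | w x ≠ 0} ≤ ∏ k, ENNReal.ofReal (T k)) :
    L ^ p * volume {x | L ≤ ‖w x‖ₑ} ≤ 2 * (2 ^ (p - 1)) ^ n *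
      ∑ k, (ENNReal.ofReal (T k))⁻¹ *
        ∫⁻ h in Ioc (T k) (2 * T k), shiftMod p w (EuclideanSpace.single k h) := by
  have hp0 : 0 < p := by linarith
  set V : ℝ≥0∞ := ∏ k, ENNReal.ofReal (T k) with hV
  have hV0 : V ≠ 0 := Finset.prod_ne_zero_iff.2 fun k _ => by simpa using hT k
  have hVt : V ≠ ∞ := ENNReal.prod_ne_top fun k _ => by simp
  set B : Set (Fin n → ℝ) := univ.pi fun i => Ioc (T i) (2 * T i) with hB
  have hBm : MeasurableSet B := MeasurableSet.univ_pi fun _ => measurableSet_Ioc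
  have hBV : volume B = V := by
    rw [hB, volume_pi_pi, hV]
    refine Finset.prod_congr rfl fun i _ => ?_
    rw [Real.volume_Ioc]; congr 1; ring
  have hm := measurable_shiftMod (p := p) hw
  have hsing := fun k : Fin n => measurable_single k
  have hupper : ∫⁻ h in B, shiftMod p w (WithLp.toLp 2 h) ≤ V * ((2 ^ (p - 1)) ^ n *
      ∑ k, (ENNReal.ofReal (T k))⁻¹ *
        ∫⁻ h in Ioc (T k) (2 * T k), shiftMod p w (EuclideanSpace.single k h)) := by
    calc ∫⁻ h in B, shiftMod p w (WithLp.toLp 2 h)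
        ≤ ∫⁻ h in B, (2 ^ (p - 1)) ^ n * ∑ k, shiftMod p w (EuclideanSpace.single k (h k)) := by
          refine lintegral_mono fun h => ?_
          rw [toLp_eq_sum_single]
          simpa using shiftMod_sum_le hp hw Finset.univ fun k => EuclideanSpace.single k (h k)
      _ = (2 ^ (p - 1)) ^ n * ∑ k, ∫⁻ h in B, shiftMod p w (EuclideanSpace.single k (h k)) := by
          have hk : ∀ k : Fin n, Measurable fun h : Fin n → ℝ =>
              shiftMod p w (EuclideanSpace.single k (h k)) :=
            fun k => hm.comp ((hsing k).comp (measurable_pi_apply k))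
          rw [lintegral_const_mul _ (Finset.measurable_fun_sum _ fun k _ => hk k),
            lintegral_finsetSum _ fun k _ => hk k]
      _ = _ := by
          have hk : ∀ k : Fin n, Measurable fun t : ℝ =>
              shiftMod p w (EuclideanSpace.single k t) := fun k => hm.comp (hsing k)
          rw [Finset.sum_congr rfl fun k _ => setLIntegral_box_eval T hT k (hk k),
            ← Finset.mul_sum, mul_left_comm]
  have hlower : V / 2 * (L ^ p * volume {x | L ≤ ‖w x‖ₑ}) ≤
      ∫⁻ h in B, shiftMod p w (WithLp.toLp 2 h) := by
    have hSm : MeasurableSet {x | L ≤ ‖w x‖ₑ} := measurableSet_le measurable_const hw.enorm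
    have hto : Measurable (fun h : Fin n → ℝ => (WithLp.toLp 2 h : Space n)) := by fun_prop
    have hsw : ∫⁻ h in B, shiftMod p w (WithLp.toLp 2 h) =
        ∫⁻ x, ∫⁻ h in B, ‖w (x + WithLp.toLp 2 h) - w x‖ₑ ^ p := by
      have hd : Measurable fun z : (Fin n → ℝ) × Space n => w (z.2 + WithLp.toLp 2 z.1) :=
        hw.comp (measurable_snd.add (hto.comp measurable_fst))
      have hd' : Measurable fun z : (Fin n → ℝ) × Space n =>
          ‖w (z.2 + WithLp.toLp 2 z.1) - w z.2‖ₑ ^ p :=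
        (hd.sub (hw.comp measurable_snd)).enorm.pow_const p
      exact lintegral_lintegral_swap hd'.aemeasurable
    rw [hsw, mul_comm (L ^ p), ← mul_assoc, mul_right_comm, ← setLIntegral_const]
    refine le_trans (setLIntegral_mono' hSm fun x hx => ?_) (setLIntegral_le_lintegral _ _)
    have hNm : MeasurableSet {h : Fin n → ℝ | w (x + WithLp.toLp 2 h) ≠ 0} :=
      (measurableSet_eq_fun (hw.comp (measurable_const.add hto)) measurable_const).compl
    have hNv : volume {h : Fin n → ℝ | w (x + WithLp.toLp 2 h) ≠ 0} = volume {y | w y ≠ 0} := by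
      rw [← measure_preimage_add volume x {y : Space n | w y ≠ 0},
        ← (PiLp.volume_preserving_toLp (Fin n)).measure_preimage]
      · rfl
      · exact ((measurableSet_eq_fun (hw.comp (measurable_const.add measurable_id))
          measurable_const).compl).nullMeasurableSet
    set N := {h : Fin n → ℝ | w (x + WithLp.toLp 2 h) ≠ 0} with hN
    have hNV : volume N ≤ V / 2 := by
      rw [hNv, ENNReal.le_div_iff_mul_le (by simp) (by simp), mul_comm]; exact hA
    -- At least half of the box moves `x` to a zero of `w`.
    have hBN : V / 2 ≤ volume (B \ N) := by
      have h1 : V - V / 2 ≤ volume B - volume N := by rw [hBV]; gcongr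
      rw [ENNReal.sub_half hVt] at h1
      exact h1.trans le_measure_sdiff
    calc V / 2 * L ^ p ≤ L ^ p * volume (B \ N) := by rw [mul_comm]; gcongr
      _ = ∫⁻ h in B \ N, L ^ p := (setLIntegral_const _ _).symm
      _ ≤ ∫⁻ h in B \ N, ‖w (x + WithLp.toLp 2 h) - w x‖ₑ ^ p := by
          refine setLIntegral_mono' (hBm.diff hNm) fun h hh => ?_
          have h0 : w (x + WithLp.toLp 2 h) = 0 := by
            by_contra hne; exact hh.2 hne
          rw [h0, zero_sub, enorm_neg]
          exact ENNReal.rpow_le_rpow hx hp0.le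
      _ ≤ _ := lintegral_mono_set sdiff_subset
  have := hlower.trans hupper
  rw [ENNReal.div_eq_inv_mul, mul_comm 2⁻¹, mul_assoc, ENNReal.mul_le_mul_iff_right hV0 hVt,
    ← ENNReal.div_eq_inv_mul, ENNReal.div_le_iff (by simp) (by simp)] at this
  refine this.trans (le_of_eq ?_)
  ring

/-- The constant in `rpow_mul_volume_le_axesEnergy`. -/
noncomputable def nashConst (n : ℕ) (p s₀ : ℝ) : ℝ≥0∞ :=
  2 * (2 ^ (p - 1)) ^ n * ENNReal.ofReal (2 ^ (2 + p) * p / s₀)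

/-- A Nash-type inequality with a weak norm on the left: for `w` supported in a set of measure `a`,
the level set at height `L` is controlled by the energy. The box of increments has sides
`τ ^ (1 / s k)`, for which all directions contribute the same power `τ ^ p`, and `τ` is fixed by
the requirement that the volume `τ ^ ∑ 1 / s k` be `2 a`. -/
lemma rpow_mul_volume_le_axesEnergy {s : Fin n → ℝ} {s₀ : ℝ} (hp : 1 ≤ p) (hs₀ : 0 < s₀)
    (hs : ∀ k, s₀ ≤ s k ∧ s k < 1) (hn : 0 < ∑ k, 1 / s k) (hθ : p / ∑ k, 1 / s k ≤ 1)
    (hw : Measurable w) {L : ℝ≥0∞} (hL : L ≠ 0) (hA : volume {x | w x ≠ 0} ≠ ∞) :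
    L ^ p * volume {x | L ≤ ‖w x‖ₑ} ≤ nashConst n p s₀ * axesEnergy p s w *
      volume {x | w x ≠ 0} ^ (p / ∑ k, 1 / s k) := by
  have hp0 : 0 < p := by linarith
  have hs0 : ∀ k, 0 < s k := fun k => hs₀.trans_le (hs k).1
  set H := ∑ k, 1 / s k with hH
  set a := (volume {x | w x ≠ 0}).toReal with ha
  have hAa : volume {x | w x ≠ 0} = ENNReal.ofReal a := (ENNReal.ofReal_toReal hA).symm
  have hsub : {x | L ≤ ‖w x‖ₑ} ⊆ {x | w x ≠ 0} := fun x hx h0 => by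
    simp only [mem_ofPred_eq, h0, enorm_zero, nonpos_iff_eq_zero] at hx
    exact hL hx
  rcases (ENNReal.toReal_nonneg (a := volume {x | w x ≠ 0})).eq_or_lt with h0 | h0
  · have : volume {x | w x ≠ 0} = 0 := by rw [hAa, ha, ← h0, ENNReal.ofReal_zero]
    rw [measure_mono_null hsub this]
    simp
  rw [← ha] at h0
  -- Then `∏ k, τ ^ (1 / s k) = 2 * a`, and `(τ ^ (1 / s k)) ^ (s k * p) = τ ^ p` for every `k`.
  set τ : ℝ := (2 * a) ^ (1 / H) with hτ
  have hτ0 : 0 < τ := by positivity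
  have hT : ∀ k, 0 < τ ^ (1 / s k) := fun k => by positivity
  have hτp : τ ^ p = (2 * a) ^ (p / H) := by
    rw [hτ, ← Real.rpow_mul (by positivity)]; congr 1; ring
  have hbox := rpow_mul_volume_le_sum_shiftMod hp hw (fun k => τ ^ (1 / s k)) hT L (by
    rw [← ENNReal.ofReal_prod_of_nonneg fun k _ => (hT k).le, ← Real.rpow_sum_of_pos hτ0, ← hH, hτ,
      ← Real.rpow_mul (by positivity), one_div_mul_cancel hn.ne', Real.rpow_one,
      ENNReal.ofReal_mul two_pos.le, hAa, ENNReal.ofReal_ofNat])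
  refine hbox.trans ?_
  have hdir : ∀ k, (ENNReal.ofReal (τ ^ (1 / s k)))⁻¹ *
      ∫⁻ h in Ioc (τ ^ (1 / s k)) (2 * τ ^ (1 / s k)), shiftMod p w (EuclideanSpace.single k h) ≤
      ENNReal.ofReal (2 ^ (2 + p) * p / s₀) * ENNReal.ofReal a ^ (p / H) *
        (ENNReal.ofReal (s k * (1 - s k)) * dirEnergy p (s k) k w) := by
    intro k
    have h1s : 0 < 1 - s k := by linarith [(hs k).2]
    have hTs : (τ ^ (1 / s k)) ^ (s k * p) = (2 * a) ^ (p / H) := by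
      rw [← Real.rpow_mul hτ0.le, ← hτp]
      congr 1
      have := (hs0 k).ne'
      field_simp
    calc (ENNReal.ofReal (τ ^ (1 / s k)))⁻¹ * ∫⁻ h in Ioc (τ ^ (1 / s k)) (2 * τ ^ (1 / s k)),
            shiftMod p w (EuclideanSpace.single k h)
        ≤ (ENNReal.ofReal (τ ^ (1 / s k)))⁻¹ *
            (ENNReal.ofReal (2 ^ (1 + p) * p * τ ^ (1 / s k) * (2 * a) ^ (p / H)) *
              (ENNReal.ofReal (1 - s k) * dirEnergy p (s k) k w)) := by
          gcongr
          have := lintegral_Ioc_le_energy hp0 (hs0 k) (hs k).2 (hT k)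
            (shiftMod_two_mul_le hp hw k)
          rwa [hTs] at this
      _ = ENNReal.ofReal (2 ^ (1 + p) * p * (2 * a) ^ (p / H) * (1 - s k)) *
            dirEnergy p (s k) k w := by
          rw [← ENNReal.ofReal_inv_of_pos (hT k), ← mul_assoc, ← mul_assoc,
            ← ENNReal.ofReal_mul (by positivity), ← ENNReal.ofReal_mul (by positivity)]
          congr 2
          have := (hT k).ne'
          field_simp
      _ ≤ _ := by
          rw [ENNReal.ofReal_rpow_of_pos h0, ← mul_assoc, ← ENNReal.ofReal_mul (by positivity),
            ← ENNReal.ofReal_mul (by positivity)]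
          refine mul_le_mul_left (ENNReal.ofReal_le_ofReal ?_) _
          have h2 : (2 * a) ^ (p / H) ≤ 2 * a ^ (p / H) := by
            rw [Real.mul_rpow two_pos.le h0.le]
            gcongr
            simpa using Real.rpow_le_rpow_of_exponent_le (x := 2) (by norm_num) hθ
          have h3 : 1 ≤ s k / s₀ := (one_le_div hs₀).2 (hs k).1
          have h4 : (2 : ℝ) ^ (2 + p) = 2 * 2 ^ (1 + p) := by
            rw [show 2 + p = 1 + (1 + p) by ring, Real.rpow_add two_pos, Real.rpow_one]
          calc 2 ^ (1 + p) * p * (2 * a) ^ (p / H) * (1 - s k)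
              ≤ 2 ^ (1 + p) * p * (2 * a ^ (p / H)) * (1 - s k) := by gcongr
            _ ≤ 2 ^ (1 + p) * p * (2 * a ^ (p / H)) * (1 - s k) * (s k / s₀) :=
                le_mul_of_one_le_right (by positivity) h3
            _ = _ := by rw [h4]; ring
  calc _ ≤ 2 * (2 ^ (p - 1)) ^ n * ∑ k, ENNReal.ofReal (2 ^ (2 + p) * p / s₀) *
        ENNReal.ofReal a ^ (p / H) *
        (ENNReal.ofReal (s k * (1 - s k)) * dirEnergy p (s k) k w) := by
        exact mul_le_mul_right (Finset.sum_le_sum fun k _ => hdir k) _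
    _ = _ := by
        rw [← Finset.mul_sum, nashConst, axesEnergy, hAa]
        ring

end Nash

/-! ### Dyadic slices of a function -/

/-- The part of a height `a ≥ 0` that lies between the dyadic levels `2 ^ j` and `2 ^ (j + 1)`. -/
noncomputable def dyadicSlice (j : ℤ) (a : ℝ) : ℝ := min a (2 ^ (j + 1)) - min a (2 ^ j)

@[fun_prop]
lemma continuous_dyadicSlice (j : ℤ) : Continuous (dyadicSlice j) := by
  unfold dyadicSlice; fun_prop

lemma two_zpow_le_succ (j : ℤ) : (2 : ℝ) ^ j ≤ 2 ^ (j + 1) :=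
  zpow_le_zpow_right₀ (by norm_num) (by lia)

lemma dyadicSlice_eq_zero {j : ℤ} {a : ℝ} (h : a ≤ 2 ^ j) : dyadicSlice j a = 0 := by
  rw [dyadicSlice, min_eq_left h, min_eq_left (h.trans (two_zpow_le_succ j)), sub_self]

lemma dyadicSlice_eq {j : ℤ} {a : ℝ} (h : 2 ^ (j + 1) ≤ a) : dyadicSlice j a = 2 ^ j := by
  rw [dyadicSlice, min_eq_right h, min_eq_right ((two_zpow_le_succ j).trans h),
    zpow_add_one₀ two_ne_zero]
  ring

lemma tsum_rpow_le_rpow_tsum {ι : Type*} (x : ι → ℝ≥0∞) {p : ℝ} (hp : 1 ≤ p) :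
    ∑' j, x j ^ p ≤ (∑' j, x j) ^ p := by
  have h1 : ∀ y : ℝ≥0∞, y ^ p = y * y ^ (p - 1) := fun y => by
    conv_lhs => rw [show p = 1 + (p - 1) by ring,
      ENNReal.rpow_add_of_nonneg _ _ zero_le_one (by linarith), ENNReal.rpow_one]
  calc ∑' j, x j ^ p ≤ ∑' j, x j * (∑' i, x i) ^ (p - 1) := by
        refine ENNReal.tsum_le_tsum fun j => ?_
        rw [h1]
        exact mul_le_mul_right (ENNReal.rpow_le_rpow (ENNReal.le_tsum j) (by linarith)) _
    _ = _ := by rw [ENNReal.tsum_mul_right, ← h1]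

/-- For `b ≤ a` the function `j ↦ min a (2 ^ j) - min b (2 ^ j)` is monotone with values in
`[0, a - b]`, and the increments of `dyadicSlice` are the lengths of its disjoint jump intervals. -/
lemma tsum_enorm_dyadicSlice_sub_le {a b : ℝ} (hab : b ≤ a) :
    ∑' j : ℤ, ‖dyadicSlice j a - dyadicSlice j b‖ₑ ≤ ‖a - b‖ₑ := by
  set f : ℤ → ℝ := fun j => min a (2 ^ j) - min b (2 ^ j) with hf
  have hmono : Monotone f := by
    refine monotone_int_of_le_succ fun j => ?_
    have := two_zpow_le_succ j
    simp only [hf]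
    generalize (2 : ℝ) ^ j = c at *
    generalize (2 : ℝ) ^ (j + 1) = d at *
    grind
  have hf0 : ∀ j, 0 ≤ f j := fun j => sub_nonneg.2 (min_le_min_right _ hab)
  have hf1 : ∀ j, f j ≤ a - b := fun j => by
    simp only [hf]
    generalize (2 : ℝ) ^ j = c at *
    grind
  have hterm : ∀ j : ℤ, ‖dyadicSlice j a - dyadicSlice j b‖ₑ =
      volume (Ioc (f j) (f (Order.succ j))) := fun j => by
    have h1 : dyadicSlice j a - dyadicSlice j b = f (j + 1) - f j := by
      simp only [dyadicSlice, hf]; ring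
    rw [Real.volume_Ioc, Order.succ_eq_add_one, h1,
      Real.enorm_of_nonneg (sub_nonneg.2 (hmono (by lia)))]
  calc ∑' j : ℤ, ‖dyadicSlice j a - dyadicSlice j b‖ₑ
      = ∑' j : ℤ, volume (Ioc (f j) (f (Order.succ j))) := tsum_congr hterm
    _ = volume (⋃ j : ℤ, Ioc (f j) (f (Order.succ j))) :=
        (measure_iUnion hmono.pairwise_disjoint_on_Ioc_succ fun _ => measurableSet_Ioc).symm
    _ ≤ volume (Icc 0 (a - b)) := measure_mono (iUnion_subset fun j x hx =>
        ⟨(hf0 j).trans hx.1.le, hx.2.trans (hf1 _)⟩)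
    _ = ‖a - b‖ₑ := by
        rw [Real.volume_Icc, sub_zero, Real.enorm_of_nonneg (sub_nonneg.2 hab)]

lemma tsum_enorm_rpow_dyadicSlice_sub_le {p : ℝ} (hp : 1 ≤ p) (a b : ℝ) :
    ∑' j : ℤ, ‖dyadicSlice j a - dyadicSlice j b‖ₑ ^ p ≤ ‖a - b‖ₑ ^ p := by
  wlog hab : b ≤ a generalizing a b
  · have := this b a (le_of_not_ge hab)
    simpa only [enorm_sub_rev a b, enorm_sub_rev (dyadicSlice _ a)] using this
  exact (tsum_rpow_le_rpow_tsum _ hp).trans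
    (ENNReal.rpow_le_rpow (tsum_enorm_dyadicSlice_sub_le hab) (by linarith))

section Truncation

variable {n : ℕ} {p : ℝ} {v : Space n → ℝ}

lemma measurable_dyadicSlice_abs (hv : Measurable v) (j : ℤ) :
    Measurable fun x => dyadicSlice j |v x| :=
  (continuous_dyadicSlice j).measurable.comp (continuous_abs.measurable.comp hv)

lemma tsum_shiftMod_dyadicSlice_le (hp : 1 ≤ p) (hv : Measurable v) (a : Space n) :
    ∑' j : ℤ, shiftMod p (fun x => dyadicSlice j |v x|) a ≤ shiftMod p v a := by
  simp only [shiftMod]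
  have hm := measurable_dyadicSlice_abs hv
  have hm' : ∀ j : ℤ, Measurable fun x => ‖dyadicSlice j |v (x + a)| - dyadicSlice j |v x|‖ₑ ^ p :=
    fun j => (((hm j).comp (measurable_id.add_const a)).sub (hm j)).enorm.pow_const p
  rw [← lintegral_tsum fun j => (hm' j).aemeasurable]
  refine lintegral_mono fun x => (tsum_enorm_rpow_dyadicSlice_sub_le hp _ _).trans ?_
  refine ENNReal.rpow_le_rpow ?_ (by linarith)
  rw [enorm_le_iff_norm_le]
  exact abs_abs_sub_abs_le_abs_sub _ _

/-- The energies of the dyadic slices of `|v|` add up to at most the energy of `v`. -/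
lemma tsum_axesEnergy_dyadicSlice_le (hp : 1 ≤ p) (hv : Measurable v) (s : Fin n → ℝ) :
    ∑' j : ℤ, axesEnergy p s (fun x => dyadicSlice j |v x|) ≤ axesEnergy p s v := by
  simp only [axesEnergy]
  rw [Summable.tsum_finsetSum fun _ _ => ENNReal.summable]
  refine Finset.sum_le_sum fun k _ => ?_
  rw [ENNReal.tsum_mul_left]
  gcongr
  simp only [dirEnergy]
  have hw : Measurable fun h : ℝ => ENNReal.ofReal (|h| ^ (-1 - s k * p)) := by fun_prop
  have hm : ∀ j : ℤ, Measurable fun h : ℝ =>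
      shiftMod p (fun x => dyadicSlice j |v x|) (EuclideanSpace.single k h) :=
    fun j => (measurable_shiftMod (measurable_dyadicSlice_abs hv j)).comp (measurable_single k)
  have hmw : ∀ j : ℤ, Measurable fun h : ℝ =>
      shiftMod p (fun x => dyadicSlice j |v x|) (EuclideanSpace.single k h) *
        ENNReal.ofReal (|h| ^ (-1 - s k * p)) := fun j => (hm j).mul hw
  rw [← lintegral_tsum fun j => (hmw j).aemeasurable]
  refine lintegral_mono fun h => ?_
  rw [ENNReal.tsum_mul_right]
  gcongr
  exact tsum_shiftMod_dyadicSlice_le hp hv _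

end Truncation

/-! ### The Sobolev inequality on the whole space -/

lemma le_rpow_of_le_mul_rpow {B X : ℝ≥0∞} {θ : ℝ} (hθ : θ < 1) (hB : B ≠ ∞)
    (h : B ≤ X * B ^ θ) : B ≤ X ^ (1 / (1 - θ)) := by
  rcases eq_or_ne B 0 with rfl | h0
  · simp
  have h1 : 0 < 1 - θ := by linarith
  rw [one_div, ENNReal.le_rpow_inv_iff h1, ENNReal.rpow_sub _ _ h0 hB, ENNReal.rpow_one]
  exact ENNReal.div_le_of_le_mul h

/-- Summation of a weak-type inequality over dyadic levels. With `b j = 2 ^ (j q) a j` the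
hypothesis reads `b (j + 1) ≤ 2 ^ q D e j (b j) ^ θ`. The a priori bound `A` makes
`sup_{j ≤ J} b j` finite, so that it can be absorbed, which bounds all `b j`; inserting this bound
on the right and summing over `j` gives the claim. -/
lemma tsum_dyadic_le {a e : ℤ → ℝ≥0∞} {D A : ℝ≥0∞} {p q θ : ℝ} (hq : 0 < q)
    (hθ0 : 0 ≤ θ) (hθ : θ < 1) (hqp : q * (1 - θ) = p) (hA : A ≠ ∞) (haA : ∀ j, a j ≤ A)
    (h : ∀ j : ℤ, 2 ^ (j * p) * a (j + 1) ≤ D * e j * a j ^ θ) :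
    ∑' j : ℤ, 2 ^ (j * q) * a j ≤ (2 ^ q * D * ∑' j, e j) ^ (q / p) := by
  have h1θ : 0 < 1 - θ := by linarith
  have hexp : q / p = 1 / (1 - θ) := by rw [← hqp]; field_simp
  set X := 2 ^ q * D * ∑' j, e j with hX
  set b : ℤ → ℝ≥0∞ := fun j => 2 ^ (j * q) * a j with hb
  have hstep : ∀ j, b (j + 1) ≤ 2 ^ q * D * e j * b j ^ θ := fun j => by
    have h2 : (2 : ℝ≥0∞) ^ (((j + 1 : ℤ) : ℝ) * q) = 2 ^ q * 2 ^ (j * q * θ) * 2 ^ (j * p) := by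
      rw [← ENNReal.rpow_add _ _ (by simp) (by simp), ← ENNReal.rpow_add _ _ (by simp) (by simp)]
      congr 1
      push_cast
      linear_combination (j : ℝ) * hqp
    simp only [hb]
    rw [h2, ENNReal.mul_rpow_of_nonneg _ _ hθ0, ← ENNReal.rpow_mul, mul_assoc]
    calc 2 ^ q * 2 ^ (j * q * θ) * (2 ^ (j * p) * a (j + 1))
        ≤ 2 ^ q * 2 ^ (j * q * θ) * (D * e j * a j ^ θ) := mul_le_mul_right (h j) _
      _ = _ := by ring
  -- Only levels up to `J` enter the supremum: this makes it finite, and the recursion stays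
  -- inside because it bounds `b j` by `b (j - 1)`.
  have hbound : ∀ J : ℤ, b J ≤ X ^ (1 / (1 - θ)) := fun J => by
    set B := ⨆ j : Iic J, b j with hB
    have hBtop : B ≠ ∞ := by
      refine ne_top_of_le_ne_top (b := 2 ^ ((J : ℝ) * q) * A) ?_ (iSup_le fun j => ?_)
      · exact ENNReal.mul_ne_top (ENNReal.rpow_ne_top_of_ne_zero (by simp) (by simp)) hA
      · have hjJ : ((j : ℤ) : ℝ) ≤ J := by exact_mod_cast j.2
        exact mul_le_mul' (ENNReal.rpow_le_rpow_of_exponent_le (by norm_num) (by gcongr)) (haA j)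
    refine (le_iSup (fun j : Iic J => b j) ⟨J, self_mem_Iic⟩).trans
      (le_rpow_of_le_mul_rpow hθ hBtop (iSup_le fun j => ?_))
    have h3 := hstep (j - 1)
    rw [sub_add_cancel] at h3
    refine h3.trans ?_
    have h4 : b ((j : ℤ) - 1) ≤ B :=
      le_iSup (fun j : Iic J => b j) ⟨(j : ℤ) - 1, mem_Iic.2 ((sub_one_lt _).le.trans j.2)⟩
    rw [hX]
    gcongr
    exact ENNReal.le_tsum _
  rw [hexp]
  calc ∑' j : ℤ, b j = ∑' j : ℤ, b (j + 1) := ((Equiv.addRight (1 : ℤ)).tsum_eq b).symm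
    _ ≤ ∑' j : ℤ, 2 ^ q * D * e j * (X ^ (1 / (1 - θ))) ^ θ := by
        refine ENNReal.tsum_le_tsum fun j => (hstep j).trans ?_
        gcongr
        exact hbound j
    _ = X * (X ^ (1 / (1 - θ))) ^ θ := by
        rw [ENNReal.tsum_mul_right, ENNReal.tsum_mul_left]
    _ = X ^ (1 / (1 - θ)) := by
        rw [← ENNReal.rpow_mul]
        nth_rewrite 1 [← ENNReal.rpow_one X]
        rw [← ENNReal.rpow_add_of_nonneg _ _ zero_le_one (by positivity)]
        congr 1
        field_simp
        ring

lemma ofReal_two_zpow (j : ℤ) : ENNReal.ofReal (2 ^ j) = (2 : ℝ≥0∞) ^ (j : ℝ) := by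
  rw [← Real.rpow_intCast, ← ENNReal.ofReal_rpow_of_pos two_pos, ENNReal.ofReal_ofNat]

/-- A function is controlled by its dyadic levels. -/
lemma lintegral_enorm_rpow_le_tsum {α : Type*} [MeasurableSpace α] {μ : Measure α} {v : α → ℝ}
    (hv : Measurable v) {q : ℝ} (hq : 0 < q) :
    ∫⁻ x, ‖v x‖ₑ ^ q ∂μ ≤ 2 ^ q * ∑' j : ℤ, 2 ^ (j * q) * μ {x | 2 ^ j < |v x|} := by
  have hm : ∀ j : ℤ, MeasurableSet {x | 2 ^ j < |v x|} := fun j =>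
    measurableSet_lt measurable_const (continuous_abs.measurable.comp hv)
  calc ∫⁻ x, ‖v x‖ₑ ^ q ∂μ
      ≤ ∫⁻ x, ∑' j : ℤ, {x | 2 ^ j < |v x|}.indicator
          (fun _ => (2 : ℝ≥0∞) ^ (((j + 1 : ℤ) : ℝ) * q)) x ∂μ := by
        refine lintegral_mono fun x => ?_
        rcases eq_or_ne (v x) 0 with h0 | h0
        · simp [h0, hq]
        · obtain ⟨j, hj⟩ := exists_mem_Ioc_zpow (abs_pos.2 h0) one_lt_two
          refine le_trans ?_ (ENNReal.le_tsum j)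
          rw [indicator_of_mem (by exact hj.1), ENNReal.rpow_mul, ← ofReal_two_zpow,
            ← Real.enorm_abs, Real.enorm_of_nonneg (abs_nonneg _)]
          exact ENNReal.rpow_le_rpow (ENNReal.ofReal_le_ofReal hj.2) hq.le
    _ = ∑' j : ℤ, 2 ^ (((j + 1 : ℤ) : ℝ) * q) * μ {x | 2 ^ j < |v x|} := by
        rw [lintegral_tsum fun j => (measurable_const.indicator (hm j)).aemeasurable]
        exact tsum_congr fun j => lintegral_indicator_const (hm j) _
    _ = _ := by
        rw [← ENNReal.tsum_mul_left]
        refine tsum_congr fun j => ?_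
        rw [← mul_assoc, ← ENNReal.rpow_add _ _ (by simp) (by simp)]
        congr 2
        push_cast
        ring

/-- The anisotropic fractional Sobolev inequality on the whole space, with a constant that does not
degenerate as the orders tend to `1`. -/
theorem lintegral_rpow_le_axesEnergy {n : ℕ} {p q s₀ : ℝ} {s : Fin n → ℝ} (hp : 1 ≤ p)
    (hs₀ : 0 < s₀) (hs : ∀ k, s₀ ≤ s k ∧ s k < 1) (hH : p < ∑ k, 1 / s k)
    (hq : q * (1 - p / ∑ k, 1 / s k) = p) {v : Space n → ℝ} (hv : Measurable v)
    (hsupp : volume {x | v x ≠ 0} ≠ ∞) :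
    ∫⁻ x, ‖v x‖ₑ ^ q ≤ 2 ^ q * (2 ^ q * nashConst n p s₀ * axesEnergy p s v) ^ (q / p) := by
  have hp0 : 0 < p := by linarith
  have hH0 : 0 < ∑ k, 1 / s k := hp0.trans hH
  set θ := p / ∑ k, 1 / s k with hθ
  have hθ1 : θ < 1 := (div_lt_one hH0).2 hH
  have hq0 : 0 < q := by
    by_contra hle
    nlinarith
  refine (lintegral_enorm_rpow_le_tsum hv hq0).trans ?_
  gcongr
  have hsub : ∀ j : ℤ, {x | 2 ^ j < |v x|} ⊆ {x | v x ≠ 0} := fun j x hx h0 => by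
    have h1 : (2 : ℝ) ^ j < |v x| := hx
    rw [h0, abs_zero] at h1
    exact absurd h1 (not_lt.2 (by positivity))
  refine (tsum_dyadic_le (e := fun j => axesEnergy p s fun x => dyadicSlice j |v x|)
    (D := nashConst n p s₀) hq0 (by positivity) hθ1 hq hsupp
    (fun j => measure_mono (hsub j)) fun j => ?_).trans ?_
  · have hne : {x | dyadicSlice j |v x| ≠ 0} ⊆ {x | 2 ^ j < |v x|} := fun x hx => by
      by_contra hle
      exact hx (dyadicSlice_eq_zero (not_lt.1 hle))
    have hle : {x | (2 : ℝ) ^ (j + 1) < |v x|} ⊆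
        {x | (2 : ℝ≥0∞) ^ (j : ℝ) ≤ ‖dyadicSlice j |v x|‖ₑ} := fun x hx => by
      have h1 : (2 : ℝ) ^ (j + 1) < |v x| := hx
      change (2 : ℝ≥0∞) ^ (j : ℝ) ≤ ‖dyadicSlice j |v x|‖ₑ
      rw [dyadicSlice_eq h1.le, Real.enorm_of_nonneg (by positivity), ofReal_two_zpow]
    have hN := rpow_mul_volume_le_axesEnergy (L := 2 ^ (j : ℝ)) hp hs₀ hs hH0 hθ1.le
      (measurable_dyadicSlice_abs hv j) (ENNReal.rpow_pos (by simp) (by simp)).ne'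
      (ne_top_of_le_ne_top hsupp (measure_mono (hne.trans (hsub j))))
    rw [← ENNReal.rpow_mul] at hN
    calc _ ≤ _ := mul_le_mul_right (measure_mono hle) _
      _ ≤ _ := hN
      _ ≤ _ := mul_le_mul_right (ENNReal.rpow_le_rpow (measure_mono hne) (by positivity)) _
  · gcongr
    exact tsum_axesEnergy_dyadicSlice_le hp hv s

/-! ### Cutoff functions -/

lemma lintegral_comp_abs_eq (F : ℝ → ℝ≥0∞) :
    ∫⁻ h : ℝ, F |h| = 2 * ∫⁻ h in Ioi (0 : ℝ), F h := by
  have h1 : ∫⁻ h in Ioi (0 : ℝ), F |h| = ∫⁻ h in Ioi (0 : ℝ), F h :=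
    setLIntegral_congr_fun measurableSet_Ioi fun h hh => by rw [abs_of_pos hh]
  have h2 : ∫⁻ h in Iio (0 : ℝ), F |h| = ∫⁻ h in Ioi (0 : ℝ), F |h| := by
    rw [← lintegral_indicator measurableSet_Iio, ← lintegral_indicator measurableSet_Ioi,
      ← lintegral_neg_eq_self]
    refine lintegral_congr fun h => ?_
    simp [indicator]
  have h3 := lintegral_add_compl (μ := volume) (fun h => F |h|) (measurableSet_Ioi (a := (0 : ℝ)))
  rw [← h3, compl_Ioi, setLIntegral_congr Iio_ae_eq_Iic.symm, h2, h1, two_mul]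

lemma lintegral_Ioc_rpow {c d : ℝ} (hc : -1 < c) (hd : 0 < d) :
    ∫⁻ h in Ioc 0 d, ENNReal.ofReal (h ^ c) = ENNReal.ofReal (d ^ (c + 1) / (c + 1)) := by
  have hi := intervalIntegral.intervalIntegrable_rpow' (a := 0) (b := d) hc
  rw [intervalIntegrable_iff_integrableOn_Ioc_of_le hd.le] at hi
  rw [← ofReal_integral_eq_lintegral_ofReal hi, ← intervalIntegral.integral_of_le hd.le,
    integral_rpow (Or.inl hc), Real.zero_rpow (by linarith), sub_zero]
  filter_upwards [ae_restrict_mem measurableSet_Ioc] with x hx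
  exact Real.rpow_nonneg hx.1.le _

lemma lintegral_Ioi_rpow {c d : ℝ} (hc : c < -1) (hd : 0 < d) :
    ∫⁻ h in Ioi d, ENNReal.ofReal (h ^ c) = ENNReal.ofReal (-d ^ (c + 1) / (c + 1)) := by
  rw [← ofReal_integral_eq_lintegral_ofReal (integrableOn_Ioi_rpow_of_lt hc hd),
    integral_Ioi_rpow_of_lt hc hd]
  filter_upwards [ae_restrict_mem measurableSet_Ioi] with x hx
  exact Real.rpow_nonneg (hd.le.trans (le_of_lt hx)) _

/-- The energy density of a cutoff of slope `1 / d`. The singular part near `0` and the tail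
contribute `σ` and `1 - σ` times `(2 / p) d ^ (-σ p)`, so that the bound is uniform in `σ`. -/
lemma lintegral_cutoff_kernel_le {p σ d : ℝ} (hp : 1 ≤ p) (hσ0 : 0 < σ) (hσ : σ < 1) (hd : 0 < d) :
    ENNReal.ofReal (σ * (1 - σ)) * ∫⁻ h : ℝ, ENNReal.ofReal (min 1 (|h| / d) ^ p) *
      ENNReal.ofReal (|h| ^ (-1 - σ * p)) ≤ ENNReal.ofReal (2 * d ^ (-(σ * p))) := by
  have hp0 : 0 < p := by linarith
  have hσ1 : 0 < 1 - σ := by linarith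
  have hσp : 0 < σ * p := mul_pos hσ0 hp0
  have hnear : ∫⁻ h in Ioc 0 d, ENNReal.ofReal (min 1 (h / d) ^ p) *
      ENNReal.ofReal (h ^ (-1 - σ * p)) = ENNReal.ofReal (d ^ (-(σ * p)) / ((1 - σ) * p)) := by
    calc _ = ∫⁻ h in Ioc 0 d, ENNReal.ofReal (d ^ (-p)) * ENNReal.ofReal (h ^ (p - 1 - σ * p)) := by
          refine setLIntegral_congr_fun measurableSet_Ioc fun h hh => ?_
          have h0 : 0 < h := hh.1
          rw [min_eq_right ((div_le_one hd).2 hh.2), ← ENNReal.ofReal_mul (by positivity),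
            ← ENNReal.ofReal_mul (by positivity), Real.div_rpow h0.le hd.le, Real.rpow_neg hd.le,
            show p - 1 - σ * p = p + (-1 - σ * p) by ring, Real.rpow_add h0]
          congr 1
          ring
      _ = _ := by
          rw [lintegral_const_mul' _ _ (by simp), lintegral_Ioc_rpow (by nlinarith) hd,
            ← ENNReal.ofReal_mul (by positivity), ← mul_div_assoc, ← Real.rpow_add hd]
          congr 2
          · congr 1; ring
          · ring
  have hfar : ∫⁻ h in Ioi d, ENNReal.ofReal (min 1 (h / d) ^ p) *
      ENNReal.ofReal (h ^ (-1 - σ * p)) = ENNReal.ofReal (d ^ (-(σ * p)) / (σ * p)) := by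
    calc _ = ∫⁻ h in Ioi d, ENNReal.ofReal (h ^ (-1 - σ * p)) := by
          refine setLIntegral_congr_fun measurableSet_Ioi fun h hh => ?_
          rw [min_eq_left ((one_le_div hd).2 (le_of_lt hh)), Real.one_rpow, ENNReal.ofReal_one,
            one_mul]
      _ = _ := by
          rw [lintegral_Ioi_rpow (by linarith) hd,
            show -1 - σ * p + 1 = -(σ * p) by ring, neg_div_neg_eq]
  rw [lintegral_comp_abs_eq fun h => ENNReal.ofReal (min 1 (h / d) ^ p) *
      ENNReal.ofReal (h ^ (-1 - σ * p)), ← Ioc_union_Ioi_eq_Ioi hd.le,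
    lintegral_union measurableSet_Ioi (Ioc_disjoint_Ioi le_rfl), hnear, hfar,
    ← ENNReal.ofReal_add (by positivity) (by positivity), ← ENNReal.ofReal_ofNat 2,
    ← ENNReal.ofReal_mul two_pos.le, ← ENNReal.ofReal_mul (by positivity)]
  refine ENNReal.ofReal_le_ofReal ?_
  have : σ * (1 - σ) * (2 * (d ^ (-(σ * p)) / ((1 - σ) * p) + d ^ (-(σ * p)) / (σ * p))) =
      2 * d ^ (-(σ * p)) / p := by
    field_simp
    ring
  rw [this]
  exact div_le_self (by positivity) hp

/-- The piecewise linear function that is `0` for `y ≤ 0` and `1` for `y ≥ d`. -/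
noncomputable def ramp (d y : ℝ) : ℝ := max 0 (min 1 (y / d))

lemma ramp_nonneg (d y : ℝ) : 0 ≤ ramp d y := le_max_left _ _

lemma ramp_le_one (d y : ℝ) : ramp d y ≤ 1 := max_le zero_le_one (min_le_left _ _)

lemma ramp_eq_zero {d y : ℝ} (hd : 0 < d) (hy : y ≤ 0) : ramp d y = 0 :=
  max_eq_left ((min_le_right _ _).trans (div_nonpos_of_nonpos_of_nonneg hy hd.le))

lemma ramp_eq_one {d y : ℝ} (hd : 0 < d) (hy : d ≤ y) : ramp d y = 1 := by
  rw [ramp, min_eq_left ((one_le_div hd).2 hy), max_eq_right zero_le_one]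

lemma abs_ramp_sub_le {d : ℝ} (hd : 0 < d) (y z : ℝ) :
    |ramp d y - ramp d z| ≤ min 1 (|y - z| / d) := by
  refine le_min ?_ ?_
  · rw [abs_le]
    constructor <;> linarith [ramp_nonneg d y, ramp_nonneg d z, ramp_le_one d y, ramp_le_one d z]
  · have h1 : |y - z| / d = |y / d - z / d| := by rw [← sub_div, abs_div, abs_of_pos hd]
    rw [h1, ramp, ramp, max_comm 0, max_comm 0]
    refine (abs_max_sub_max_le_abs _ _ _).trans ((abs_min_sub_min_le_max _ _ _ _).trans ?_)
    simp

/-- The product cutoff that is `1` where `|x k - x₀ k| ≤ R k - d k` for all `k`, and `0` where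
`|x k - x₀ k| ≥ R k` for some `k`. -/
noncomputable def cutoff {n : ℕ} (R d : Fin n → ℝ) (x₀ x : Space n) : ℝ :=
  ∏ k, ramp (d k) (R k - |x k - x₀ k|)

section Cutoff

variable {n : ℕ} {R d : Fin n → ℝ} {x₀ : Space n}

lemma measurable_cutoff : Measurable (cutoff R d x₀) := by
  unfold cutoff ramp
  fun_prop

lemma cutoff_nonneg (x : Space n) : 0 ≤ cutoff R d x₀ x :=
  Finset.prod_nonneg fun _ _ => ramp_nonneg _ _

lemma cutoff_le_one (x : Space n) : cutoff R d x₀ x ≤ 1 :=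
  Finset.prod_le_one (fun _ _ => ramp_nonneg _ _) fun _ _ => ramp_le_one _ _

lemma cutoff_eq_zero (hd : ∀ k, 0 < d k) {x : Space n} {k : Fin n} (hx : R k ≤ |x k - x₀ k|) :
    cutoff R d x₀ x = 0 :=
  Finset.prod_eq_zero (Finset.mem_univ k) (ramp_eq_zero (hd k) (by linarith))

lemma cutoff_eq_one (hd : ∀ k, 0 < d k) {x : Space n} (hx : ∀ k, |x k - x₀ k| ≤ R k - d k) :
    cutoff R d x₀ x = 1 :=
  Finset.prod_eq_one fun k _ => ramp_eq_one (hd k) (by linarith [hx k])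

lemma abs_cutoff_sub_le (hd : ∀ k, 0 < d k) (x : Space n) (k : Fin n) (h : ℝ) :
    |cutoff R d x₀ (x + EuclideanSpace.single k h) - cutoff R d x₀ x| ≤ min 1 (|h| / d k) := by
  have hP : ∏ i ∈ Finset.univ.erase k,
      ramp (d i) (R i - |(x + EuclideanSpace.single k h) i - x₀ i|) =
      ∏ i ∈ Finset.univ.erase k, ramp (d i) (R i - |x i - x₀ i|) :=
    Finset.prod_congr rfl fun i hi => by simp [Finset.ne_of_mem_erase hi]
  rw [cutoff, cutoff, ← Finset.mul_prod_erase _ _ (Finset.mem_univ k), hP,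
    ← Finset.mul_prod_erase Finset.univ (fun i => ramp (d i) (R i - |x i - x₀ i|))
      (Finset.mem_univ k), ← sub_mul, abs_mul,
    abs_of_nonneg (Finset.prod_nonneg fun i _ => ramp_nonneg _ _)]
  refine (mul_le_of_le_one_right (abs_nonneg _) (Finset.prod_le_one (fun i _ => ramp_nonneg _ _)
    fun i _ => ramp_le_one _ _)).trans ((abs_ramp_sub_le (hd k) _ _).trans ?_)
  refine min_le_min_left _ (div_le_div_of_nonneg_right ?_ (hd k).le)
  have h1 : R k - |(x + EuclideanSpace.single k h) k - x₀ k| - (R k - |x k - x₀ k|) =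
      |x k - x₀ k| - |x k + h - x₀ k| := by simp
  rw [h1]
  refine (abs_abs_sub_abs_le_abs_sub _ _).trans (le_of_eq ?_)
  rw [show x k - x₀ k - (x k + h - x₀ k) = -h by ring, abs_neg]

end Cutoff

/-! ### Localization of the energy -/

/-- The discrete product rule, with the increment of `u` only for pairs of points in `M`. -/
lemma enorm_mul_sub_mul_rpow_le {α : Type*} {M : Set α} {u τ : α → ℝ} {p : ℝ} (hp : 1 ≤ p)
    (hτ0 : ∀ x, 0 ≤ τ x) (hτ1 : ∀ x, τ x ≤ 1) (hu : ∀ x, x ∉ M → u x = 0)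
    (hτ : ∀ x, x ∉ M → τ x = 0) (x y : α) :
    ‖τ y * u y - τ x * u x‖ₑ ^ p ≤ 2 ^ (p - 1) *
      (M.indicator (fun x => M.indicator (fun y => ‖u y - u x‖ₑ ^ p) y) x +
        (‖u x‖ₑ ^ p + ‖u y‖ₑ ^ p) * ‖τ y - τ x‖ₑ ^ p) := by
  have hp0 : 0 ≤ p := by linarith
  have h1 : (1 : ℝ≥0∞) ≤ 2 ^ (p - 1) := by
    simpa using ENNReal.rpow_le_rpow_of_exponent_le (x := 2) (by norm_num) (sub_nonneg.2 hp)
  by_cases hx : x ∈ M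
  · by_cases hy : y ∈ M
    · have he : τ y * u y - τ x * u x = τ y * (u y - u x) + (τ y - τ x) * u x := by ring
      rw [he, indicator_of_mem hx, indicator_of_mem hy]
      refine (enorm_add_rpow_le hp _ _).trans ?_
      rw [enorm_mul, enorm_mul, ENNReal.mul_rpow_of_nonneg _ _ hp0,
        ENNReal.mul_rpow_of_nonneg _ _ hp0]
      refine mul_le_mul_right (add_le_add ?_ ?_) _
      · refine mul_le_of_le_one_left zero_le (ENNReal.rpow_le_one ?_ hp0)
        rw [Real.enorm_of_nonneg (hτ0 y)]
        exact ENNReal.ofReal_le_one.2 (hτ1 y)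
      · rw [mul_comm]
        gcongr
        exact le_self_add
    · have he : τ y * u y - τ x * u x = (τ y - τ x) * u x := by
        rw [hu y hy, hτ y hy]; ring
      rw [he, enorm_mul, ENNReal.mul_rpow_of_nonneg _ _ hp0, mul_comm (‖τ y - τ x‖ₑ ^ p)]
      refine le_trans ?_ (le_mul_of_one_le_left zero_le h1)
      refine le_trans ?_ le_add_self
      gcongr
      exact le_self_add
  · have he : τ y * u y - τ x * u x = (τ y - τ x) * u y := by
      rw [hu x hx, hτ x hx]; ring
    rw [he, enorm_mul, ENNReal.mul_rpow_of_nonneg _ _ hp0, mul_comm (‖τ y - τ x‖ₑ ^ p)]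
    refine le_trans ?_ (le_mul_of_one_le_left zero_le h1)
    refine le_trans ?_ le_add_self
    gcongr
    exact le_add_self

/-- The part of `shiftMod p u a` that comes from pairs `x, x + a` in `M`. -/
noncomputable def localShiftMod {n : ℕ} (p : ℝ) (M : Set (Space n)) (u : Space n → ℝ)
    (a : Space n) : ℝ≥0∞ :=
  ∫⁻ x, M.indicator (fun x => M.indicator (fun y => ‖u y - u x‖ₑ ^ p) (x + a)) x

section Localization

variable {n : ℕ} {p : ℝ} {M : Set (Space n)} {u : Space n → ℝ}

lemma measurable_indicator_diff_rpow (hM : MeasurableSet M) (hu : Measurable u) :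
    Measurable fun z : Space n × Space n =>
      M.indicator (fun x => M.indicator (fun y => ‖u y - u x‖ₑ ^ p) (x + z.2)) z.1 := by
  have h1 : MeasurableSet {z : Space n × Space n | z.1 ∈ M ∧ z.1 + z.2 ∈ M} :=
    (measurable_fst hM).inter ((measurable_fst.add measurable_snd) hM)
  convert (measurable_diff_rpow (p := p) hu).indicator h1 using 1
  ext z
  by_cases h2 : z.1 ∈ M <;> by_cases h3 : z.1 + z.2 ∈ M <;> simp [h2, h3]

lemma measurable_localShiftMod (hM : MeasurableSet M) (hu : Measurable u) :
    Measurable (localShiftMod p M u) :=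
  Measurable.lintegral_prod_left' (measurable_indicator_diff_rpow (p := p) hM hu)

lemma energy_muAxes_eq (s : Fin n → ℝ) (hp : 0 ≤ p) (hs : ∀ k, 0 ≤ s k * (1 - s k))
    (hM : MeasurableSet M) (hu : Measurable u) :
    energy p (muAxes p s) M u = ∑ k, ENNReal.ofReal (s k * (1 - s k)) *
      ∫⁻ h : ℝ, localShiftMod p M u (EuclideanSpace.single k h) *
        ENNReal.ofReal (|h| ^ (-1 - s k * p)) := by
  have hW : ∀ k, Measurable fun h : ℝ => ENNReal.ofReal (|h| ^ (-1 - s k * p)) :=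
    fun k => by fun_prop
  have hI := measurable_indicator_diff_rpow (p := p) hM hu
  have hpair : ∀ k : Fin n, Measurable fun z : Space n × ℝ =>
      M.indicator (fun x => M.indicator (fun y => ‖u y - u x‖ₑ ^ p)
        (x + EuclideanSpace.single k z.2)) z.1 *
        ENNReal.ofReal (|z.2| ^ (-1 - s k * p)) := fun k =>
    (hI.comp (measurable_fst.prodMk ((measurable_single k).comp measurable_snd))).mul
      ((hW k).comp measurable_snd)
  have hinner : ∀ x ∈ M, ∫⁻ y in M, ENNReal.ofReal (|u y - u x| ^ p) ∂(muAxes p s x) =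
      ∑ k, ENNReal.ofReal (s k * (1 - s k)) * ∫⁻ h : ℝ,
        M.indicator (fun x => M.indicator (fun y => ‖u y - u x‖ₑ ^ p)
          (x + EuclideanSpace.single k h)) x * ENNReal.ofReal (|h| ^ (-1 - s k * p)) := by
    intro x hx
    have hf : Measurable (M.indicator fun y => ‖u y - u x‖ₑ ^ p) :=
      Measurable.indicator (by fun_prop) hM
    rw [← lintegral_indicator hM]
    simp only [ofReal_abs_rpow hp]
    rw [muAxes, lintegral_finsetSum_measure]
    refine Finset.sum_congr rfl fun k _ => ?_
    have hsh : Measurable fun h : ℝ => x + EuclideanSpace.single k h :=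
      (measurable_single k).const_add x
    have hden : Measurable fun h : ℝ =>
        ENNReal.ofReal (s k * (1 - s k) * |h| ^ (-1 - s k * p)) := by fun_prop
    have hfsh : Measurable fun h : ℝ =>
        M.indicator (fun y => ‖u y - u x‖ₑ ^ p) (x + EuclideanSpace.single k h) := hf.comp hsh
    rw [lintegral_map hf hsh, lintegral_withDensity_eq_lintegral_mul _ hden hfsh,
      ← lintegral_const_mul' _ _ (by simp)]
    refine lintegral_congr fun h => ?_
    simp only [Pi.mul_apply, indicator_of_mem hx]
    rw [ENNReal.ofReal_mul (hs k)]
    ring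
  rw [energy, setLIntegral_congr_fun hM hinner, ← lintegral_indicator hM]
  have hout : ∀ x, M.indicator (fun x => ∑ k, ENNReal.ofReal (s k * (1 - s k)) * ∫⁻ h : ℝ,
        M.indicator (fun x => M.indicator (fun y => ‖u y - u x‖ₑ ^ p)
          (x + EuclideanSpace.single k h)) x * ENNReal.ofReal (|h| ^ (-1 - s k * p))) x =
      ∑ k, ENNReal.ofReal (s k * (1 - s k)) * ∫⁻ h : ℝ,
        M.indicator (fun x => M.indicator (fun y => ‖u y - u x‖ₑ ^ p)
          (x + EuclideanSpace.single k h)) x * ENNReal.ofReal (|h| ^ (-1 - s k * p)) := by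
    intro x
    by_cases hx : x ∈ M <;> simp [hx]
  rw [lintegral_congr hout, lintegral_finsetSum _ fun k _ =>
    ((hpair k).lintegral_prod_right').const_mul _]
  refine Finset.sum_congr rfl fun k _ => ?_
  rw [lintegral_const_mul' _ _ (by simp), lintegral_lintegral_swap (hpair k).aemeasurable]
  congr 1
  refine lintegral_congr fun h => ?_
  simp only
  rw [lintegral_mul_const' _ _ (by simp), localShiftMod]

/-- Cutting off costs, in each direction, the `L^p` norm times `d k ^ (-(s k p))`. -/
lemma axesEnergy_cutoff_mul_le {s R d : Fin n → ℝ} {x₀ : Space n} (hp : 1 ≤ p)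
    (hs : ∀ k, 0 < s k ∧ s k < 1) (hd : ∀ k, 0 < d k) (hM : MeasurableSet M) (hu : Measurable u)
    (hu0 : ∀ x, x ∉ M → u x = 0) (hτ0 : ∀ x, x ∉ M → cutoff R d x₀ x = 0) :
    axesEnergy p s (fun x => cutoff R d x₀ x * u x) ≤ 2 ^ (p - 1) *
      (energy p (muAxes p s) M u +
        ENNReal.ofReal (4 * ∑ k, d k ^ (-(s k * p))) * ∫⁻ x, ‖u x‖ₑ ^ p) := by
  have hp0 : 0 ≤ p := by linarith
  have h2top : (2 : ℝ≥0∞) ^ (p - 1) ≠ ∞ := ENNReal.rpow_ne_top_of_ne_zero (by simp) (by simp)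
  set N := ∫⁻ x, ‖u x‖ₑ ^ p with hN
  have hshift : ∀ (k : Fin n) (h : ℝ), shiftMod p (fun x => cutoff R d x₀ x * u x)
      (EuclideanSpace.single k h) ≤ 2 ^ (p - 1) *
        (localShiftMod p M u (EuclideanSpace.single k h) +
          2 * N * ENNReal.ofReal (min 1 (|h| / d k) ^ p)) := by
    intro k h
    set a : Space n := EuclideanSpace.single k h
    set m := ENNReal.ofReal (min 1 (|h| / d k) ^ p)
    have hI : Measurable fun x =>
        M.indicator (fun x => M.indicator (fun y => ‖u y - u x‖ₑ ^ p) (x + a)) x :=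
      (measurable_indicator_diff_rpow (p := p) hM hu).comp (measurable_id.prodMk measurable_const)
    calc shiftMod p (fun x => cutoff R d x₀ x * u x) a
        ≤ ∫⁻ x, 2 ^ (p - 1) *
            (M.indicator (fun x => M.indicator (fun y => ‖u y - u x‖ₑ ^ p) (x + a)) x +
              (‖u x‖ₑ ^ p + ‖u (x + a)‖ₑ ^ p) * m) := by
          refine lintegral_mono fun x => (enorm_mul_sub_mul_rpow_le hp cutoff_nonneg cutoff_le_one
            hu0 hτ0 x (x + a)).trans ?_
          have hm : ‖cutoff R d x₀ (x + a) - cutoff R d x₀ x‖ₑ ^ p ≤ m := by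
            rw [← ofReal_abs_rpow hp0]
            exact ENNReal.ofReal_le_ofReal
              (Real.rpow_le_rpow (abs_nonneg _) (abs_cutoff_sub_le hd x k h) hp0)
          gcongr
      _ = _ := by
          rw [lintegral_const_mul' _ _ h2top, lintegral_add_left hI,
            lintegral_mul_const' _ _ (by simp [m]), lintegral_add_left (by fun_prop),
            lintegral_add_right_eq_self (fun x => ‖u x‖ₑ ^ p) a, ← two_mul, localShiftMod]
  have hdir : ∀ k : Fin n, ENNReal.ofReal (s k * (1 - s k)) *
      dirEnergy p (s k) k (fun x => cutoff R d x₀ x * u x) ≤ 2 ^ (p - 1) *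
        (ENNReal.ofReal (s k * (1 - s k)) * (∫⁻ h : ℝ,
          localShiftMod p M u (EuclideanSpace.single k h) * ENNReal.ofReal (|h| ^ (-1 - s k * p))) +
          2 * N * ENNReal.ofReal (2 * d k ^ (-(s k * p)))) := by
    intro k
    set W : ℝ → ℝ≥0∞ := fun h => ENNReal.ofReal (|h| ^ (-1 - s k * p)) with hW
    have hWm : Measurable W := by fun_prop
    have hm : Measurable fun h : ℝ => ENNReal.ofReal (min 1 (|h| / d k) ^ p) := by fun_prop
    have hmW : Measurable fun h : ℝ => ENNReal.ofReal (min 1 (|h| / d k) ^ p) * W h :=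
      hm.mul hWm
    have hL : Measurable fun h : ℝ => localShiftMod p M u (EuclideanSpace.single k h) * W h :=
      ((measurable_localShiftMod hM hu).comp (measurable_single k)).mul hWm
    calc ENNReal.ofReal (s k * (1 - s k)) *
          dirEnergy p (s k) k (fun x => cutoff R d x₀ x * u x)
        ≤ ENNReal.ofReal (s k * (1 - s k)) * ∫⁻ h : ℝ, 2 ^ (p - 1) *
            (localShiftMod p M u (EuclideanSpace.single k h) * W h +
              2 * N * (ENNReal.ofReal (min 1 (|h| / d k) ^ p) * W h)) := by
          refine mul_le_mul_right (lintegral_mono fun h => ?_) _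
          refine (mul_le_mul_left (hshift k h) _).trans (le_of_eq ?_)
          simp only [hW]
          ring
      _ = 2 ^ (p - 1) * (ENNReal.ofReal (s k * (1 - s k)) * (∫⁻ h : ℝ,
            localShiftMod p M u (EuclideanSpace.single k h) * W h) +
            2 * N * (ENNReal.ofReal (s k * (1 - s k)) *
              ∫⁻ h : ℝ, ENNReal.ofReal (min 1 (|h| / d k) ^ p) * W h)) := by
          rw [lintegral_const_mul' _ _ h2top, lintegral_add_left hL,
            lintegral_const_mul _ hmW]
          ring
      _ ≤ _ := by
          refine mul_le_mul_right (add_le_add_right (mul_le_mul_right ?_ _) _) _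
          exact lintegral_cutoff_kernel_le hp (hs k).1 (hs k).2 (hd k)
  calc axesEnergy p s (fun x => cutoff R d x₀ x * u x) ≤ _ := Finset.sum_le_sum fun k _ => hdir k
    _ = _ := by
        rw [← Finset.mul_sum, Finset.sum_add_distrib, ← energy_muAxes_eq s hp0
          (fun k => mul_nonneg (hs k).1.le (by linarith [(hs k).2])) hM hu, ← Finset.mul_sum,
          ← ENNReal.ofReal_sum_of_nonneg fun k _ => by have := hd k; positivity,
          ← Finset.mul_sum, ENNReal.ofReal_mul two_pos.le, ENNReal.ofReal_mul (by norm_num),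
          ENNReal.ofReal_ofNat, ENNReal.ofReal_ofNat]
        ring

end Localization

/-! ### Rectangles and exponents -/

lemma normL_eq {n : ℕ} {q : ℝ} (hq : 0 < q) (Ω : Set (Space n)) (u : Space n → ℝ) :
    normL q Ω u = (∫⁻ x in Ω, ‖u x‖ₑ ^ q) ^ (1 / q) := by
  rw [normL, eLpNorm_eq_lintegral_rpow_enorm_toReal (by simpa using hq) (by simp),
    ENNReal.toReal_ofReal hq.le]

lemma mem_rect_iff {n : ℕ} {s : Fin n → ℝ} {r : ℝ} {x y : Space n} :
    y ∈ rect s r x ↔ ∀ k, |y k - x k| < r ^ (sMax s / s k) := by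
  simp only [rect, mem_ofPred_eq, mem_Ioo, abs_lt]
  refine forall_congr' fun k => ?_
  constructor <;> rintro ⟨h1, h2⟩ <;> constructor <;> linarith

lemma rect_eq_preimage {n : ℕ} (s : Fin n → ℝ) (r : ℝ) (x : Space n) :
    rect s r x = WithLp.ofLp ⁻¹' univ.pi fun k =>
      Ioo (x k - r ^ (sMax s / s k)) (x k + r ^ (sMax s / s k)) := by
  ext y
  simp only [rect, mem_ofPred_eq, mem_preimage, mem_univ_pi]

lemma measurableSet_rect {n : ℕ} (s : Fin n → ℝ) (r : ℝ) (x : Space n) :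
    MeasurableSet (rect s r x) := by
  rw [rect_eq_preimage]
  exact (PiLp.volume_preserving_ofLp (Fin n)).measurable
    (MeasurableSet.univ_pi fun _ => measurableSet_Ioo)

lemma volume_rect_ne_top {n : ℕ} (s : Fin n → ℝ) (r : ℝ) (x : Space n) :
    volume (rect s r x) ≠ ∞ := by
  rw [rect_eq_preimage, (PiLp.volume_preserving_ofLp (Fin n)).measure_preimage
    (MeasurableSet.univ_pi fun _ => measurableSet_Ioo).nullMeasurableSet, volume_pi_pi]
  exact ENNReal.prod_ne_top fun k _ => by simp

lemma sMax_pos {n : ℕ} {s : Fin n → ℝ} (k : Fin n) (hs : ∀ k, 0 < s k) : 0 < sMax s :=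
  (hs k).trans_le (le_ciSup (finite_range s).bddAbove k)

lemma div_sBar_eq {n : ℕ} (hn : 1 ≤ n) (s : Fin n → ℝ) : n / sBar s = ∑ k, 1 / s k := by
  have : (n : ℝ) ≠ 0 := by positivity
  rw [sBar, div_inv_eq_mul]
  field_simp

lemma sobolevExponent_mul_eq {n : ℕ} (hn : 1 ≤ n) {p : ℝ} {s : Fin n → ℝ} (hp : 0 < p)
    (hH : p < ∑ k, 1 / s k) :
    sobolevExponent p s * (1 - p / ∑ k, 1 / s k) = p := by
  have hn0 : (n : ℝ) ≠ 0 := by positivity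
  have hH0 : 0 < ∑ k, 1 / s k := hp.trans hH
  rw [sobolevExponent, sBar]
  set H := ∑ k, 1 / s k
  have h1 : (n : ℝ) - p * (1 / n * H)⁻¹ = n * (1 - p / H) := by
    field_simp
  have h2 : 1 - p / H ≠ 0 := (sub_pos.2 ((div_lt_one hH0).2 hH)).ne'
  rw [h1, mul_div_mul_left _ _ hn0, div_mul_cancel₀ _ h2]

/-- The Sobolev inequality for `cutoff * u`, with the cutoff adapted to concentric rectangles. -/
lemma normL_rpow_le_energy_muAxes {n : ℕ} {p q s₀ : ℝ} {s : Fin n → ℝ} (hp : 1 < p) (hs₀ : 0 < s₀)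
    (hs : ∀ k, s₀ ≤ s k ∧ s k < 1) (hH : p < ∑ k, 1 / s k)
    (hq : q * (1 - p / ∑ k, 1 / s k) = p) {x₀ : Space n} {r lam : ℝ} (hr : 0 < r) (hlam : 1 < lam)
    {u : Space n → ℝ} (hu : Measurable u) (hu0 : ∀ x, x ∉ rect s (lam * r) x₀ → u x = 0) :
    normL q (rect s r x₀) u ^ p ≤ 2 ^ p * (2 ^ q * nashConst n p s₀) * 2 ^ (p - 1) *
      (energy p (muAxes p s) (rect s (lam * r) x₀) u +
        ENNReal.ofReal (4 * ((∑ k, (lam ^ (sMax s / s k) - 1) ^ (-(s k * p))) *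
          r ^ (-(p * sMax s)))) * normL p (rect s (lam * r) x₀) u ^ p) := by
  have hp0 : 0 < p := by linarith
  have hs0 : ∀ k, 0 < s k := fun k => hs₀.trans_le (hs k).1
  have hθ1 : p / ∑ k, 1 / s k < 1 := (div_lt_one (hp0.trans hH)).2 hH
  have hq0 : 0 < q := by
    by_contra hle
    nlinarith
  have he : ∀ k, 0 < sMax s / s k := fun k => div_pos (sMax_pos k hs0) (hs0 k)
  set M := rect s (lam * r) x₀ with hMdef
  have hM : MeasurableSet M := measurableSet_rect _ _ _
  set R : Fin n → ℝ := fun k => (lam * r) ^ (sMax s / s k) with hR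
  set d : Fin n → ℝ := fun k => R k - r ^ (sMax s / s k) with hd
  have hgap : ∀ k, 0 < lam ^ (sMax s / s k) - 1 := fun k =>
    sub_pos.2 (Real.one_lt_rpow hlam (he k))
  have hdk : ∀ k, d k = r ^ (sMax s / s k) * (lam ^ (sMax s / s k) - 1) := fun k => by
    simp only [hd, hR]
    rw [Real.mul_rpow (by linarith) hr.le]
    ring
  have hd0 : ∀ k, 0 < d k := fun k => by
    rw [hdk]; exact mul_pos (by positivity) (hgap k)
  have hsum : ∑ k, d k ^ (-(s k * p)) =
      (∑ k, (lam ^ (sMax s / s k) - 1) ^ (-(s k * p))) * r ^ (-(p * sMax s)) := by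
    rw [Finset.sum_mul]
    refine Finset.sum_congr rfl fun k _ => ?_
    rw [hdk, Real.mul_rpow (by positivity) (hgap k).le, ← Real.rpow_mul hr.le, mul_comm]
    congr 2
    have := (hs0 k).ne'
    field_simp
  have hτ0 : ∀ x, x ∉ M → cutoff R d x₀ x = 0 := fun x hx => by
    rw [hMdef, mem_rect_iff] at hx
    push Not at hx
    obtain ⟨k, hk⟩ := hx
    exact cutoff_eq_zero hd0 hk
  have hτ1 : ∀ x ∈ rect s r x₀, cutoff R d x₀ x = 1 := fun x hx =>
    cutoff_eq_one hd0 fun k => by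
      simp only [hd, sub_sub_cancel]
      exact (mem_rect_iff.1 hx k).le
  set v : Space n → ℝ := fun x => cutoff R d x₀ x * u x with hv
  have hvm : Measurable v := measurable_cutoff.mul hu
  have hsupp : volume {x | v x ≠ 0} ≠ ∞ := by
    refine ne_top_of_le_ne_top (volume_rect_ne_top s (lam * r) x₀) (measure_mono fun x hx => ?_)
    by_contra hxM
    exact hx (by simp only [hv, hu0 x hxM, mul_zero])
  have hN : normL p M u ^ p = ∫⁻ x, ‖u x‖ₑ ^ p := by
    rw [normL_eq hp0, ← ENNReal.rpow_mul, one_div_mul_cancel hp0.ne', ENNReal.rpow_one,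
      ← lintegral_indicator hM]
    refine lintegral_congr fun x => ?_
    by_cases hx : x ∈ M
    · simp [hx]
    · simp [hx, hu0 x hx, hp0]
  have henergy := axesEnergy_cutoff_mul_le hp.le (fun k => ⟨hs0 k, (hs k).2⟩) hd0 hM hu hu0 hτ0
  rw [hsum, ← hN] at henergy
  calc normL q (rect s r x₀) u ^ p
      = (∫⁻ x in rect s r x₀, ‖v x‖ₑ ^ q) ^ (p / q) := by
        rw [normL_eq hq0, ← ENNReal.rpow_mul, one_div_mul_eq_div]
        congr 1
        refine setLIntegral_congr_fun (measurableSet_rect _ _ _) fun x hx => ?_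
        simp only [hv, hτ1 x hx, one_mul]
    _ ≤ (2 ^ q * (2 ^ q * nashConst n p s₀ * axesEnergy p s v) ^ (q / p)) ^ (p / q) := by
        refine ENNReal.rpow_le_rpow ((setLIntegral_le_lintegral _ _).trans ?_) (by positivity)
        exact lintegral_rpow_le_axesEnergy hp.le hs₀ hs hH hq hvm hsupp
    _ = 2 ^ p * (2 ^ q * nashConst n p s₀) * axesEnergy p s v := by
        rw [ENNReal.mul_rpow_of_nonneg _ _ (by positivity), ← ENNReal.rpow_mul, ← ENNReal.rpow_mul,
          show q * (p / q) = p by field_simp, show q / p * (p / q) = 1 by field_simp,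
          ENNReal.rpow_one, ← mul_assoc]
    _ ≤ _ := by
        rw [mul_assoc _ ((2 : ℝ≥0∞) ^ (p - 1))]
        exact mul_le_mul_right henergy _

end AnisotropicNonlocal

theorem corollary2p5 (n : ℕ) (hn : 1 ≤ n) (p pstar s₀ Λ : ℝ) (hp : 1 < p)
    (hs₀ : 0 < s₀) (hs₀' : s₀ < 1) (hΛ : 1 ≤ Λ) :
    ∃ C : ℝ, 0 < C ∧
      ∀ s : Fin n → ℝ, (∀ k, s₀ ≤ s k ∧ s k < 1) →
        p < (n : ℝ) / sBar s → pstar = sobolevExponent p s →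
        ∀ μ : Space n → Measure (Space n), Admissible p s Λ μ →
        ∀ (x₀ : Space n) (r lam : ℝ), 0 < r → r ≤ 1 → 1 < lam → lam ≤ 2 →
        ∀ u : Space n → ℝ, MemH p μ (rect s (lam * r) x₀) u →
          normL pstar (rect s r x₀) u ^ p ≤
            ENNReal.ofReal C * energy p μ (rect s (lam * r) x₀) u +
            ENNReal.ofReal
                (C * (∑ k, (lam ^ (sMax s / s k) - 1) ^ (-(s k * p))) * r ^ (-(p * sMax s))) *
              normL p (rect s (lam * r) x₀) u ^ p := by
  have hp0 : 0 < p := by linarith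
  have h2 : ∀ t : ℝ, (2 : ℝ≥0∞) ^ t ≠ ∞ := fun t =>
    ENNReal.rpow_ne_top_of_ne_zero (by simp) (by simp)
  set K : ℝ≥0∞ := 2 ^ p * (2 ^ pstar * nashConst n p s₀) * 2 ^ (p - 1) with hK
  have hKtop : K ≠ ∞ := by
    have hN : nashConst n p s₀ ≠ ∞ :=
      ENNReal.mul_ne_top (ENNReal.mul_ne_top (by simp) (ENNReal.pow_ne_top (h2 _))) (by simp)
    exact ENNReal.mul_ne_top (ENNReal.mul_ne_top (h2 _) (ENNReal.mul_ne_top (h2 _) hN)) (h2 _)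
  have hKle : K ≤ ENNReal.ofReal (K.toReal + 1) := by
    rw [ENNReal.le_ofReal_iff_toReal_le hKtop (by positivity)]
    linarith
  have hK0 : 0 < K.toReal + 1 := by positivity
  refine ⟨4 * Λ * (K.toReal + 1), by positivity, ?_⟩
  intro s hs hps hpstar μ hμ x₀ r lam hr hr1 hlam hlam2 u hu
  rw [div_sBar_eq hn] at hps
  have hq : pstar * (1 - p / ∑ k, 1 / s k) = p := by
    rw [hpstar]; exact sobolevExponent_mul_eq hn hp0 hps
  have hmem : MemLp u (ENNReal.ofReal p) (volume.restrict (rect s (lam * r) x₀)) :=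
    ⟨hu.measurable.aestronglyMeasurable,
      (ENNReal.rpow_lt_top_iff_of_pos hp0).1 (le_self_add.trans_lt hu.finite)⟩
  -- Here `lam * r ≤ 2 < 3`.
  have hcomp := (hμ.comparable x₀ (lam * r) (by positivity) (by nlinarith) u hmem).2
  refine (normL_rpow_le_energy_muAxes hp hs₀ hs hps hq hr hlam hu.measurable hu.eq_zero).trans ?_
  rw [← hK, mul_add]
  set S := (∑ k, (lam ^ (sMax s / s k) - 1) ^ (-(s k * p))) * r ^ (-(p * sMax s)) with hS
  have hS0 : 0 ≤ S := by
    refine mul_nonneg (Finset.sum_nonneg fun k _ => Real.rpow_nonneg ?_ _) (by positivity)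
    have hs0 : ∀ k, 0 < s k := fun k => hs₀.trans_le (hs k).1
    exact sub_nonneg.2 (Real.one_le_rpow hlam.le (div_pos (sMax_pos k hs0) (hs0 k)).le)
  refine add_le_add ?_ ?_
  · calc K * energy p (muAxes p s) (rect s (lam * r) x₀) u
        ≤ ENNReal.ofReal (K.toReal + 1) *
            (ENNReal.ofReal Λ * energy p μ (rect s (lam * r) x₀) u) := mul_le_mul' hKle hcomp
      _ ≤ _ := by
          rw [← mul_assoc, ← ENNReal.ofReal_mul hK0.le]
          refine mul_le_mul_left (ENNReal.ofReal_le_ofReal ?_) _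
          nlinarith [mul_pos hK0 (by linarith : 0 < Λ)]
  · rw [← mul_assoc]
    refine mul_le_mul_left ((mul_le_mul_left hKle _).trans ?_) _
    rw [← ENNReal.ofReal_mul hK0.le, mul_assoc _ (∑ k, _) (r ^ _), ← hS]
    refine ENNReal.ofReal_le_ofReal ?_
    nlinarith [mul_nonneg hK0.le hS0]
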